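/- Let $n\ge 2$, $d=n(n+1)/2$, $t=n(n-1)/2$ (so $n+t=d$). Let $Sh_*$ be the sharbly complex: $Sh_k$ is the $\mathbb{Q}$-vector space generated by symbols $[v_1,\dots,v_{n+k}]$ with $v_i\in\mathbb{Q}^n\setminus\{0\}$, modulo the relations (i) $[v_{\sigma(1)},\dots,v_{\sigma(n+k)}]=\mathrm{sign}(\sigma)[v_1,\dots,v_{n+k}]$, (ii) $[v_1,\dots,v_{n+k}]=0$ if the $v_i$ do not span $\mathbb{Q}^n$, (iii) $[av_1,v_2,\dots]=[v_1,v_2,\dots]$ for $a\in\mathbb{Q}^\times$; with boundary $\partial[v_1,\dots,v_{n+k}]=\sum_i(-1)^{i+1}[v_1,\dots,\widehat{v_i},\dots,v_{n+k}]$ and the action $g[v_1,\dots]=[gv_1,\dots]$. For a subgroup $G\subset \mathrm{SL}_n(\mathbb{Z})$ let $[v_1,\dots]_G$ be the image of $[v_1,\dots]$ in the $G$-coinvariants of $Sh_*$. Let $Y$ be the space of real symmetric $n\times n$ matrices with a fixed orientation, on which $\mathrm{SL}_n(\mathbb{Z})$ acts by $\gamma\cdot x=\gamma x\,{}^t\gamma$,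 and put $v'=v\,{}^tv$. A positive definite form $Q$ with minimal vectors $\pm v_1,\dots,\pm v_m$ (the nonzero integral vectors where $Q$ attains its minimum over $\mathbb{Z}^n\setminus\{0\}$) is perfect if $v_1',\dots,v_m'$ span $Y$; the tiles are the cones generated by $v'_1,\dots,v'_m$, for $Q$ perfect. If $s$ is a cone generated by a basis $v_1',\dots,v_d'$ of $Y$ with all $v_i\in\mathbb{Q}^n$ (a top-dimensional simplicial cone), put $[s]=[v_1,\dots,v_d]$, where the order is chosen so that the basis is positively oriented. For a torsion-free subgroup $D$ of finite index in $\mathrm{SL}_n(\mathbb{Z})$, a cycle $z_D$ is constructed as follows. Choose representatives $R_D$ of the $D$-orbits of tiles and a regular triangulation of each tile in $R_D$ using only vertices of the tile; let $\mathcal{S}$ be the set of all simplicial cones obtained. Put $z_D=\sum_{s\in\mathcal{S}}[s]_D+\sum_\alpha[y^\alpha_1,\dots,y^\alpha_d]_D$ where the second sum is a finite sum of flipons (symbols $[y_1,\dots,y_d]$ for which the $y_i'$ lie in an affine subspace of $Y$ of dimension $d-2$) chosen such that $\partial z_D=0$; no flipons are used if $\sum_{s\in\mathcal{S}}[s]_D$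 is already a cycle. If moreover $D$ is a normal subgroup of $G$, where $G\subset\mathrm{SL}_n(\mathbb{Z})$ has finite index, put $z_G=[G:D]^{-1}\iota(z_D)$, where $\iota([\bullet]_D)=[\bullet]_G$. Theorem. Let $n=2$ or $3$. Tiles exist, they form a single $\mathrm{SL}_n(\mathbb{Z})$-orbit, and every tile is a simplicial cone with finite stabilizer in $\mathrm{SL}_n(\mathbb{Z})$. Let $T_0$ be a tile with stabilizer $H_0$. Then $[T_0]_{\mathrm{SL}_n(\mathbb{Z})}$ is a cycle, and for every torsion-free normal subgroup $D$ of finite index in $\mathrm{SL}_n(\mathbb{Z})$ the construction can be carried out, and whatever choices are made in it, $$z_{\mathrm{SL}_n(\mathbb{Z})}=|H_0|^{-1}\,[T_0]_{\mathrm{SL}_n(\mathbb{Z})}.$$ In particular $z_{\mathrm{SL}_n(\mathbb{Z})}$ does not depend on the choice of $D$. -/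

import Mathlib

open scoped Matrix

noncomputable section

namespace VoronoiSharbly

/-! ### The sharbly complex -/

/-- Nonzero column vectors in `ℚⁿ`. -/
abbrev Vec (n : ℕ) : Type := {v : Fin n → ℚ // v ≠ 0}

/-- The group `SL_n(ℤ)`. -/
abbrev SLZ (n : ℕ) : Type := Matrix.SpecialLinearGroup (Fin n) ℤ

/-- The free `ℚ`-vector space on the symbols `[v₁, …, v_m]`. -/
abbrev FreeSymbols (n m : ℕ) : Type := (Fin m → Vec n) →₀ ℚ

/-- The symbol `[v₁, …, v_m]` in the free space. -/
def sym {n m : ℕ} (v : Fin m → Vec n) : FreeSymbols n m := Finsupp.single v 1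

/-- (i) `[v_σ(1), …, v_σ(m)] - sign(σ) [v₁, …, v_m]`. -/
def permRelations (n m : ℕ) : Set (FreeSymbols n m) :=
  {x | ∃ (v : Fin m → Vec n) (σ : Equiv.Perm (Fin m)),
    x = sym (fun i => v (σ i)) - ((Equiv.Perm.sign σ : ℤ) : ℚ) • sym v}

/-- (ii) `[v₁, …, v_m]` where `v₁, …, v_m` do not span `ℚⁿ`. -/
def spanRelations (n m : ℕ) : Set (FreeSymbols n m) :=
  {x | ∃ v : Fin m → Vec n,
    Submodule.span ℚ (Set.range fun i => (v i : Fin n → ℚ)) ≠ ⊤ ∧ x = sym v}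

/-- (iii) `[w₁, …, w_m] - [v₁, …, v_m]` where `w` is `v` with one entry multiplied by a nonzero
rational number. -/
def scaleRelations (n m : ℕ) : Set (FreeSymbols n m) :=
  {x | ∃ (v w : Fin m → Vec n) (i : Fin m) (a : ℚ),
    a ≠ 0 ∧ (w i : Fin n → ℚ) = a • (v i : Fin n → ℚ) ∧ (∀ j, j ≠ i → w j = v j) ∧
      x = sym w - sym v}

/-- The subspace of relations among the symbols with `m` entries. -/
def relations (n m : ℕ) : Submodule ℚ (FreeSymbols n m) :=
  Submodule.span ℚ (permRelations n m ∪ spanRelations n m ∪ scaleRelations n m)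

/-- The sharblies with `m` entries; thus `Sh_k` is `Sharbly n (n + k)`. -/
abbrev Sharbly (n m : ℕ) : Type := FreeSymbols n m ⧸ relations n m

/-- The basic sharbly `[v₁, …, v_m]`. -/
def basic {n m : ℕ} (v : Fin m → Vec n) : Sharbly n m := (relations n m).mkQ (sym v)

theorem basic_perm {n m : ℕ} (v : Fin m → Vec n) (σ : Equiv.Perm (Fin m)) :
    basic (fun i => v (σ i)) = ((Equiv.Perm.sign σ : ℤ) : ℚ) • basic v := by
  rw [basic, basic, ← map_smul, ← sub_eq_zero, ← map_sub, Submodule.mkQ_apply,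
    Submodule.Quotient.mk_eq_zero]
  exact Submodule.subset_span (Or.inl (Or.inl ⟨v, σ, rfl⟩))

theorem basic_span {n m : ℕ} (v : Fin m → Vec n)
    (h : Submodule.span ℚ (Set.range fun i => (v i : Fin n → ℚ)) ≠ ⊤) : basic v = 0 := by
  rw [basic, Submodule.mkQ_apply, Submodule.Quotient.mk_eq_zero]
  exact Submodule.subset_span (Or.inl (Or.inr ⟨v, h, rfl⟩))

theorem basic_scale {n m : ℕ} (v w : Fin m → Vec n) (i : Fin m) (a : ℚ) (ha : a ≠ 0)
    (hi : (w i : Fin n → ℚ) = a • (v i : Fin n → ℚ)) (hj : ∀ j, j ≠ i → w j = v j) :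
    basic w = basic v := by
  rw [basic, basic, ← sub_eq_zero, ← map_sub, Submodule.mkQ_apply, Submodule.Quotient.mk_eq_zero]
  exact Submodule.subset_span (Or.inr ⟨v, w, i, a, ha, hi, hj, rfl⟩)

/-- `∑ᵢ (-1)^i [v₀, …, v̂ᵢ, …, v_m]`, with `i` counted from `0`. -/
def boundarySum {n m : ℕ} (v : Fin (m + 1) → Vec n) : Sharbly n m :=
  ∑ i : Fin (m + 1), ((-1 : ℚ) ^ (i : ℕ)) • basic (fun j => v (i.succAbove j))

theorem boundarySum_perm {n m : ℕ} (v : Fin (m + 1) → Vec n) (σ : Equiv.Perm (Fin (m + 1))) :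
    boundarySum (fun i => v (σ i)) = ((Equiv.Perm.sign σ : ℤ) : ℚ) • boundarySum v := by
  unfold boundarySum
  rw [Finset.smul_sum]
  conv_rhs => rw [← Equiv.sum_comp σ]
  refine Finset.sum_congr rfl fun i _ => ?_
  obtain ⟨⟨p, τ⟩, hρ⟩ := Equiv.Perm.decomposeFin.symm.surjective
    ((σ i).cycleRange * σ * (i.cycleRange)⁻¹)
  have hp : p = 0 := by
    have := congrArg (fun e : Equiv.Perm (Fin (m + 1)) => e 0) hρ
    simpa [Fin.cycleRange_symm_zero] using this
  subst hp
  have hs : Equiv.Perm.sign τ = (-1) ^ (σ i : ℕ) * Equiv.Perm.sign σ * (-1) ^ (i : ℕ) := by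
    have := congrArg Equiv.Perm.sign hρ
    rw [Equiv.Perm.decomposeFin.symm_sign] at this
    simpa [Fin.sign_cycleRange] using this
  have hv : ∀ j, σ (i.succAbove j) = (σ i).succAbove (τ j) := by
    intro j
    have := congrArg (fun e : Equiv.Perm (Fin (m + 1)) => e j.succ) hρ
    simp [Fin.cycleRange_symm_succ] at this
    apply (σ i).cycleRange.injective
    rw [Fin.cycleRange_succAbove, ← this]
  simp only [hv]
  rw [basic_perm (fun j => v ((σ i).succAbove j)) τ, hs, smul_smul, smul_smul]
  congr 1
  push_cast
  have h1 : ((-1 : ℚ) ^ (i : ℕ)) * (-1) ^ (i : ℕ) = 1 := by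
    rw [← mul_pow]; simp
  linear_combination ((-1 : ℚ) ^ (σ i : ℕ) * ((Equiv.Perm.sign σ : ℤ) : ℚ)) * h1

/-- The boundary map `∂ : Sh_k → Sh_{k-1}`, from `m` entries to `m - 1` entries. -/
def boundary (n : ℕ) : (m : ℕ) → Sharbly n m →ₗ[ℚ] Sharbly n (m - 1)
  | 0 => 0
  | m + 1 =>
    (relations n (m + 1)).liftQ (Finsupp.linearCombination ℚ (boundarySum (n := n) (m := m))) <| by
      rw [relations, Submodule.span_le]
      rintro x ((⟨v, σ, rfl⟩ | ⟨v, hv, rfl⟩) | ⟨v, w, i, a, ha, hi, hj, rfl⟩)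
      · simp [sym, boundarySum_perm]
      · simp only [sym, SetLike.mem_coe, LinearMap.mem_ker, Finsupp.linearCombination_single,
          one_smul]
        refine Finset.sum_eq_zero fun i _ => ?_
        rw [basic_span, smul_zero]
        intro h
        refine hv (top_le_iff.1 (h ▸ Submodule.span_mono ?_))
        rintro _ ⟨j, rfl⟩
        exact ⟨i.succAbove j, rfl⟩
      · simp only [sym, SetLike.mem_coe, LinearMap.mem_ker, map_sub,
          Finsupp.linearCombination_single, one_smul, sub_eq_zero]
        refine Finset.sum_congr rfl fun j _ => ?_
        congr 1
        rcases eq_or_ne i j with rfl | hij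
        · exact congrArg basic (funext fun k => hj _ (Fin.succAbove_ne i k))
        · obtain ⟨k, rfl⟩ := Fin.exists_succAbove_eq hij
          exact basic_scale _ _ k a ha hi fun l hl =>
            hj _ fun h => hl (Fin.succAbove_right_injective h)

theorem boundary_basic {n m : ℕ} (v : Fin (m + 1) → Vec n) :
    boundary n (m + 1) (basic v) =
      ∑ i : Fin (m + 1), ((-1 : ℚ) ^ (i : ℕ)) • basic (fun j => v (i.succAbove j)) := by
  change Finsupp.linearCombination ℚ (boundarySum (n := n) (m := m)) (sym v) = _
  simp [sym, boundarySum]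

/-! ### The action of `GL_n(ℚ)` and coinvariants -/

/-- The action of `g ∈ GL_n(ℚ)` on nonzero column vectors. -/
def actVec {n : ℕ} (g : GL (Fin n) ℚ) (v : Vec n) : Vec n :=
  ⟨(g : Matrix (Fin n) (Fin n) ℚ) *ᵥ (v : Fin n → ℚ), fun h => v.2 <| by
    have h2 := congrArg (fun x => ((g⁻¹ : GL (Fin n) ℚ) : Matrix (Fin n) (Fin n) ℚ) *ᵥ x) h
    simpa [Matrix.mulVec_mulVec, ← Matrix.GeneralLinearGroup.coe_mul,
      -Matrix.coe_units_inv] using h2⟩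

theorem actVec_one {n : ℕ} (v : Vec n) : actVec 1 v = v := by
  apply Subtype.ext; simp [actVec]

theorem actVec_mul {n : ℕ} (g h : GL (Fin n) ℚ) (v : Vec n) :
    actVec (g * h) v = actVec g (actVec h v) := by
  apply Subtype.ext; simp [actVec, Matrix.mulVec_mulVec]

/-- The action of `g ∈ GL_n(ℚ)` on sharblies, `g [v₁, …, v_m] = [g v₁, …, g v_m]`. -/
def actSharbly {n : ℕ} (m : ℕ) (g : GL (Fin n) ℚ) : Sharbly n m →ₗ[ℚ] Sharbly n m :=
  (relations n m).liftQ
    (Finsupp.linearCombination ℚ fun v : Fin m → Vec n => basic fun i => actVec g (v i)) <| by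
    refine Submodule.span_le.2 ?_
    rintro x ((⟨v, σ, rfl⟩ | ⟨v, hv, rfl⟩) | ⟨v, w, i, a, ha, hi, hj, rfl⟩)
    · simp [sym, basic_perm (fun i => actVec g (v i)) σ]
    · simp only [sym, SetLike.mem_coe, LinearMap.mem_ker, Finsupp.linearCombination_single,
        one_smul]
      refine basic_span _ fun h => hv ?_
      have h1 : (Set.range fun i => (actVec g (v i) : Fin n → ℚ)) =
          (Matrix.toLin' (g : Matrix (Fin n) (Fin n) ℚ)) ''
            (Set.range fun i => (v i : Fin n → ℚ)) := by
        rw [← Set.range_comp]; rfl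
      rw [h1, Submodule.span_image] at h
      have hinj : Function.Injective (Matrix.toLin' (g : Matrix (Fin n) (Fin n) ℚ)) := by
        intro x y hxy
        have h2 := congrArg
          (fun x => ((g⁻¹ : GL (Fin n) ℚ) : Matrix (Fin n) (Fin n) ℚ) *ᵥ x) hxy
        simpa [Matrix.mulVec_mulVec, ← Matrix.GeneralLinearGroup.coe_mul,
          -Matrix.coe_units_inv] using h2
      rw [← Submodule.comap_map_eq_of_injective hinj
        (Submodule.span ℚ (Set.range fun i => (v i : Fin n → ℚ))), h, Submodule.comap_top]
    · simp only [sym, SetLike.mem_coe, LinearMap.mem_ker, map_sub,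
        Finsupp.linearCombination_single, one_smul, sub_eq_zero]
      refine basic_scale _ _ i a ha ?_ fun j hji => by rw [hj j hji]
      simp [actVec, hi, Matrix.mulVec_smul]

theorem actSharbly_basic {n m : ℕ} (g : GL (Fin n) ℚ) (v : Fin m → Vec n) :
    actSharbly m g (basic v) = basic fun i => actVec g (v i) := by
  change Finsupp.linearCombination ℚ (fun v : Fin m → Vec n => basic fun i => actVec g (v i))
    (sym v) = _
  simp [sym]

theorem sharbly_hom_ext {n m : ℕ} {W : Type*} [AddCommGroup W] [Module ℚ W]
    {f g : Sharbly n m →ₗ[ℚ] W} (h : ∀ v, f (basic v) = g (basic v)) : f = g := by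
  apply Submodule.linearMap_qext
  apply Finsupp.lhom_ext'
  intro v
  apply LinearMap.ext_ring
  exact h v

/-- The sharblies as a representation of `GL_n(ℚ)`. -/
def sharblyRep (n m : ℕ) : Representation ℚ (GL (Fin n) ℚ) (Sharbly n m) where
  toFun := actSharbly m
  map_one' := sharbly_hom_ext fun v => by simp [actSharbly_basic, actVec_one]
  map_mul' g h := sharbly_hom_ext fun v => by simp [actSharbly_basic, actVec_mul]

/-- The sharblies as a representation of a subgroup `G` of `SL_n(ℤ)`. -/
def sharblyRes {n : ℕ} (m : ℕ) (G : Subgroup (SLZ n)) : Representation ℚ G (Sharbly n m) :=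
  (sharblyRep n m).comp ((Matrix.SpecialLinearGroup.mapGL ℚ).comp G.subtype)

/-- The `G`-coinvariants `Sh_* ⊗_G ℚ` of the sharblies with `m` entries. -/
abbrev SharblyCoinv {n : ℕ} (m : ℕ) (G : Subgroup (SLZ n)) : Type :=
  (sharblyRes m G).Coinvariants

/-- `[v₁, …, v_m]_G`, the image of `[v₁, …, v_m]` in the `G`-coinvariants. -/
def basicCoinv {n m : ℕ} (G : Subgroup (SLZ n)) (v : Fin m → Vec n) : SharblyCoinv m G :=
  Representation.Coinvariants.mk (sharblyRes m G) (basic v)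

theorem boundary_actSharbly {n : ℕ} (m : ℕ) (g : GL (Fin n) ℚ) (x : Sharbly n m) :
    boundary n m (actSharbly m g x) = actSharbly (m - 1) g (boundary n m x) := by
  cases m with
  | zero => simp [boundary]
  | succ m =>
    have : boundary n (m + 1) ∘ₗ actSharbly (m + 1) g = actSharbly m g ∘ₗ boundary n (m + 1) :=
      sharbly_hom_ext fun v => by
        change boundary n (m + 1) (actSharbly (m + 1) g (basic v)) =
          actSharbly m g (boundary n (m + 1) (basic v))
        rw [actSharbly_basic]
        refine (boundary_basic _).trans ?_
        refine Eq.trans ?_ (congrArg (actSharbly m g) (boundary_basic v)).symm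
        simp [map_sum, actSharbly_basic]
    exact LinearMap.congr_fun this x

/-- The boundary map induced on `G`-coinvariants. -/
def boundaryCoinv {n : ℕ} (m : ℕ) (G : Subgroup (SLZ n)) :
    SharblyCoinv m G →ₗ[ℚ] SharblyCoinv (m - 1) G :=
  Representation.Coinvariants.lift _
    (Representation.Coinvariants.mk (sharblyRes (m - 1) G) ∘ₗ boundary n m) fun g =>
      LinearMap.ext fun x => by
        have h : boundary n m (sharblyRes m G g x) = sharblyRes (m - 1) G g (boundary n m x) :=
          boundary_actSharbly m _ x
        simp [h]

/-- The map `ι : [•]_D ↦ [•]_G` for `D ≤ G`. -/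
def coinvMap {n : ℕ} (m : ℕ) {D G : Subgroup (SLZ n)} (h : D ≤ G) :
    SharblyCoinv m D →ₗ[ℚ] SharblyCoinv m G :=
  Representation.Coinvariants.lift _ (Representation.Coinvariants.mk (sharblyRes m G)) fun g =>
    LinearMap.ext fun x =>
      Representation.Coinvariants.mk_self_apply (sharblyRes m G) (Subgroup.inclusion h g) x

/-! ### The perfect Voronoi cellulation -/

/-- The real vector space `Y` of symmetric real `n × n` matrices. -/
def SymMat (n : ℕ) : Submodule ℝ (Matrix (Fin n) (Fin n) ℝ) where
  carrier := {A | A.IsSymm}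
  add_mem' ha hb := ha.add hb
  zero_mem' := Matrix.isSymm_zero
  smul_mem' c _ ha := ha.smul c

/-- `d = n (n + 1) / 2`, the dimension of `Y`. -/
abbrev dimY (n : ℕ) : ℕ := n * (n + 1) / 2

/-- `v' = v ᵗv`, as an element of `Y`. -/
def rankOne {n : ℕ} (v : Fin n → ℚ) : SymMat n :=
  ⟨Matrix.vecMulVec (fun i => (v i : ℝ)) (fun i => (v i : ℝ)), by
    change Matrix.IsSymm _
    ext i j
    simp [Matrix.vecMulVec_apply, mul_comm]⟩

/-- The action `γ · x = γ x ᵗγ` of `SL_n(ℤ)` on `Y`. -/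
def actY {n : ℕ} (γ : SLZ n) : SymMat n →ₗ[ℝ] SymMat n where
  toFun x := ⟨(γ : Matrix (Fin n) (Fin n) ℤ).map (Int.cast : ℤ → ℝ) * (x : Matrix _ _ ℝ) *
      ((γ : Matrix (Fin n) (Fin n) ℤ).map (Int.cast : ℤ → ℝ))ᵀ, by
    have hx : (x : Matrix (Fin n) (Fin n) ℝ)ᵀ = x := x.2
    change Matrix.IsSymm _
    simp [Matrix.IsSymm, Matrix.transpose_mul, Matrix.mul_assoc, hx]⟩
  map_add' x y := by
    apply Subtype.ext
    simp [Matrix.mul_add, Matrix.add_mul]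
  map_smul' c x := by
    apply Subtype.ext
    simp

theorem actY_one {n : ℕ} : actY (1 : SLZ n) = LinearMap.id := by
  ext x : 1
  apply Subtype.ext
  simp [actY]

theorem actY_mul {n : ℕ} (γ δ : SLZ n) : actY (γ * δ) = actY γ ∘ₗ actY δ := by
  ext x : 1
  apply Subtype.ext
  have h : ((γ : Matrix (Fin n) (Fin n) ℤ) * (δ : Matrix (Fin n) (Fin n) ℤ)).map
      (Int.cast : ℤ → ℝ) = (γ : Matrix (Fin n) (Fin n) ℤ).map (Int.cast : ℤ → ℝ) *
        (δ : Matrix (Fin n) (Fin n) ℤ).map (Int.cast : ℤ → ℝ) :=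
    Matrix.map_mul (f := Int.castRingHom ℝ)
  simp [actY, h, Matrix.transpose_mul, Matrix.mul_assoc]

/-- Convex cones in `Y` (containing `0`). -/
abbrev Cone (n : ℕ) : Type := PointedCone ℝ (SymMat n)

/-- The translate of a cone by `γ ∈ SL_n(ℤ)`. -/
def actCone {n : ℕ} (γ : SLZ n) (s : Cone n) : Cone n := PointedCone.map (actY γ) s

/-- The value `Q[v] = ᵗv Q v` of a quadratic form at an integral vector. -/
def formValue {n : ℕ} (Q : Matrix (Fin n) (Fin n) ℝ) (v : Fin n → ℤ) : ℝ :=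
  (fun i => (v i : ℝ)) ⬝ᵥ (Q *ᵥ fun i => (v i : ℝ))

/-- The minimal vectors of `Q`: the nonzero integral vectors at which `Q` takes its minimum over
the nonzero integral vectors. -/
def minVectors {n : ℕ} (Q : Matrix (Fin n) (Fin n) ℝ) : Set (Fin n → ℤ) :=
  {v | v ≠ 0 ∧ ∀ w : Fin n → ℤ, w ≠ 0 → formValue Q v ≤ formValue Q w}

/-- The set of all `v'` with `v` a minimal vector of `Q`. -/
def minRankOne {n : ℕ} (Q : Matrix (Fin n) (Fin n) ℝ) : Set (SymMat n) :=
  (fun v : Fin n → ℤ => rankOne fun i => (v i : ℚ)) '' minVectors Q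

/-- A positive definite quadratic form is perfect if the `v'`, for `v` a minimal vector,
span `Y`. -/
def IsPerfectForm {n : ℕ} (Q : Matrix (Fin n) (Fin n) ℝ) : Prop :=
  Q.PosDef ∧ Submodule.span ℝ (minRankOne Q) = ⊤

/-- The tiles: the cones `s_Q` generated by the `v'`, for `v` a minimal vector of a perfect
form `Q`. -/
def IsTile {n : ℕ} (T : Cone n) : Prop :=
  ∃ Q : Matrix (Fin n) (Fin n) ℝ, IsPerfectForm Q ∧ T = PointedCone.hull ℝ (minRankOne Q)

/-- `v'` is a vertex of the cone `T`, that is, it generates an extremal ray of `T`. -/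
def IsVertex {n : ℕ} (T : Cone n) (v : Vec n) : Prop :=
  rankOne (v : Fin n → ℚ) ∈ T ∧
    ∀ x ∈ T, ∀ y ∈ T, x + y = rankOne (v : Fin n → ℚ) →
      ∃ c : ℝ, 0 ≤ c ∧ x = c • rankOne (v : Fin n → ℚ)

/-- `v₁, …, v_d` is an oriented list of vertices of `s`: the `v_i'` generate the cone `s`, they
form a basis of `Y` (so `s` is a top-dimensional simplicial cone), and in the given order this
basis is positively oriented. Then `[s] = [v₁, …, v_d]`. -/
def IsOrientedList {n : ℕ} (o : Orientation ℝ (SymMat n) (Fin (dimY n))) (s : Cone n)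
    (v : Fin (dimY n) → Vec n) : Prop :=
  s = PointedCone.hull ℝ (Set.range fun i => rankOne (v i : Fin n → ℚ)) ∧
    ∃ b : Module.Basis (Fin (dimY n)) ℝ (SymMat n),
      (∀ i, b i = rankOne (v i : Fin n → ℚ)) ∧ b.orientation = o

/-- A triangulation of a tile `T`: a decomposition of `T` into top-dimensional simplicial cones
whose vertices are among the vertices of `T`, any two of which meet in a common face. -/
def IsTriangulation {n : ℕ} (T : Cone n) (τ : Finset (Cone n)) : Prop :=
  (∀ s ∈ τ, ∃ v : Fin (dimY n) → Vec n,
    LinearIndependent ℝ (fun i => rankOne (v i : Fin n → ℚ)) ∧ (∀ i, IsVertex T (v i)) ∧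
      s = PointedCone.hull ℝ (Set.range fun i => rankOne (v i : Fin n → ℚ))) ∧
  (⋃ s ∈ τ, (s : Set (SymMat n))) = (T : Set (SymMat n)) ∧
  ∀ s ∈ τ, ∀ s' ∈ τ, s ≠ s' →
    IsExtreme ℝ (s : Set (SymMat n)) (s ∩ s' : Set (SymMat n)) ∧
      IsExtreme ℝ (s' : Set (SymMat n)) (s ∩ s' : Set (SymMat n))

/-- A triangulation of `T` is regular (coherent) if its cones are exactly the domains of linearity
of a concave piecewise linear function `ψ` on `T`. -/
def IsRegularTriangulation {n : ℕ} (T : Cone n) (τ : Finset (Cone n)) : Prop :=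
  IsTriangulation T τ ∧
    ∃ ψ : SymMat n → ℝ, ∀ s ∈ τ, ∃ l : SymMat n →ₗ[ℝ] ℝ,
      (∀ x ∈ s, ψ x = l x) ∧ ∀ x ∈ T, x ∉ s → ψ x < l x

/-- `R` is a (finite) set of representatives of the `G`-orbits of tiles. -/
def IsTileRepresentatives {n : ℕ} (G : Subgroup (SLZ n)) (R : Finset (Cone n)) : Prop :=
  (∀ T ∈ R, IsTile T) ∧ ∀ T : Cone n, IsTile T → ∃! T', T' ∈ R ∧ ∃ g ∈ G, actCone g T' = T

/-- `[v₁, …, v_d]` is a flipon: an affine subspace of `Y` of dimension `d - 2` contains all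
the `v_i'`. -/
def IsFlipon {n : ℕ} (v : Fin (dimY n) → Vec n) : Prop :=
  ∃ A : AffineSubspace ℝ (SymMat n), Module.finrank ℝ A.direction = dimY n - 2 ∧
    ∀ i, rankOne (v i : Fin n → ℚ) ∈ A

/-- `z` is a sharbly cycle `z_D` constructed for the torsion-free group `D`: choose representatives
`R` of the `D`-orbits of tiles, a regular triangulation `τ T` of each `T ∈ R`, oriented vertex
lists `e s` of the cones in these triangulations, and flipons `w` which correct the boundary of
`∑ [s]_D`; no flipons are used where `∑ [s]_D` already has zero boundary. -/
def IsTorsionFreeCycle {n : ℕ} (o : Orientation ℝ (SymMat n) (Fin (dimY n)))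
    (D : Subgroup (SLZ n)) (z : SharblyCoinv (dimY n) D) : Prop :=
  ∃ (R : Finset (Cone n)) (τ : Cone n → Finset (Cone n)) (e : Cone n → Fin (dimY n) → Vec n)
    (w : List (Fin (dimY n) → Vec n)),
    IsTileRepresentatives D R ∧
    (∀ T ∈ R, IsRegularTriangulation T (τ T)) ∧
    (∀ T ∈ R, ∀ s ∈ τ T, IsOrientedList o s (e s)) ∧
    (∀ v ∈ w, IsFlipon v) ∧
    (boundaryCoinv (dimY n) D (∑ T ∈ R, ∑ s ∈ τ T, basicCoinv D (e s)) = 0 → w = []) ∧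
    z = (∑ T ∈ R, ∑ s ∈ τ T, basicCoinv D (e s)) + (w.map (basicCoinv D)).sum ∧
    boundaryCoinv (dimY n) D z = 0

/-- `z` is a sharbly cycle `z_G = [G : D]⁻¹ ι(z_D)` constructed for `G` from the torsion-free
subgroup `D ≤ G`. -/
def IsSharblyCycle {n : ℕ} (o : Orientation ℝ (SymMat n) (Fin (dimY n)))
    {D G : Subgroup (SLZ n)} (h : D ≤ G) (z : SharblyCoinv (dimY n) G) : Prop :=
  ∃ zD : SharblyCoinv (dimY n) D, IsTorsionFreeCycle o D zD ∧
    z = ((D.relIndex G : ℚ))⁻¹ • coinvMap (dimY n) h zD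

/-- The stabilizer of a cone in `SL_n(ℤ)`. -/
def coneStabilizer {n : ℕ} (T : Cone n) : Subgroup (SLZ n) where
  carrier := {g | actCone g T = T}
  one_mem' := by
    change actCone 1 T = T
    rw [actCone, actY_one, PointedCone.map_id]
  mul_mem' {a b} ha hb := by
    change actCone a T = T at ha
    change actCone b T = T at hb
    change actCone (a * b) T = T
    rw [actCone, actY_mul, ← PointedCone.map_map]
    exact (congrArg (PointedCone.map (actY a)) hb).trans ha
  inv_mem' {a} ha := by
    change actCone a T = T at ha
    change actCone a⁻¹ T = T
    conv_lhs => rw [← ha]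
    rw [actCone, actCone, PointedCone.map_map, ← actY_mul, inv_mul_cancel, actY_one,
      PointedCone.map_id]

end VoronoiSharbly

end

/-!
The perfect forms in two and three variables are classified from their minimal vectors modulo two.
By the parallelogram law, two minimal vectors of a form which agree modulo two are equal up to sign
(`eq_or_eq_neg_of_modTwo_eq`), and three minimal vectors whose sum is zero modulo two satisfy a
relation `z = ± x ± y` (`eq_of_modTwo_eq_add`). Perfection needs at least `n (n + 1) / 2` of the
`2 ^ n - 1` nonzero classes, so in three variables at most one class is missing, and the incidences
of the Fano plane produce minimal vectors `a`, `b`, `c`, `a + b`, `b + c`, `a + b + c`, and no others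
up to sign. Their Gram matrix is that of the root lattice `A₃`, whose covering radius is smaller
than its minimum, so `a`, `b`, `c` is a basis of `ℤ³` (`isUnit_det_of_covering`). The
same argument in two variables gives `A₂`. Hence the tiles form one orbit of simplicial cones.

A simplicial tile has only the trivial triangulation (`IsTriangulation.eq_singleton`), and the
elements of `SL_n(ℤ)` preserve the orientation of `Y` (`det_actY_pos`), so the part of `z_D` without
flipons is `∑ [T]_D` over the `D`-orbits of tiles. Each face of the tile of `A_n` has a symmetry in
`SL_n(ℤ)` which permutes its generators oddly up to sign, so each face vanishes in the coinvariants
of `SL_n(ℤ)` and the tile is a cycle there (`boundaryCoinv_eq_zero_of_symmetries`).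

The two are related by the transfer map from the coinvariants of `SL_n(ℤ)` to those of `D`. The
stabilizer `H₀` is finite and `D` is torsion-free and normal, so `H₀` acts freely on
`SL_n(ℤ) ⧸ D` and `∑ [T]_D` is `|H₀|⁻¹` times the transfer of `[T₀]`
(`sum_representatives`). As the transfer commutes with the boundary, this sum is a cycle,
whatever the incidences between tiles and their faces are, and no flipons are used. The projection
back to the coinvariants of `SL_n(ℤ)` composed with the transfer is multiplication by the index of
`D`, which gives the value of the cycle (`isSharblyCycle_iff`).
-/

open scoped Matrix

namespace VoronoiSharbly

/-! ### Simplicial cones and their vertices -/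

theorem mem_hull_range {E ι : Type*} [AddCommGroup E] [Module ℝ E] [Fintype ι] (b : ι → E)
    (x : E) : x ∈ PointedCone.hull ℝ (Set.range b) ↔
      ∃ c : ι → ℝ, (∀ i, 0 ≤ c i) ∧ ∑ i, c i • b i = x := by
  rw [PointedCone.hull, Submodule.mem_span_range_iff_exists_fun]
  constructor
  · rintro ⟨c, h⟩
    exact ⟨fun i => c i, fun i => (c i).2, h⟩
  · rintro ⟨c, hc, h⟩
    exact ⟨fun i => ⟨c i, hc i⟩, h⟩

/-- Every extremal ray of a simplicial cone is spanned by one of the generators. -/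
theorem exists_eq_smul_of_extremal {E ι : Type*} [AddCommGroup E] [Module ℝ E] [Fintype ι]
    {b : ι → E} (hb : LinearIndependent ℝ b) {u : E} (hu0 : u ≠ 0)
    (hu : u ∈ PointedCone.hull ℝ (Set.range b))
    (hext : ∀ x ∈ PointedCone.hull ℝ (Set.range b), ∀ y ∈ PointedCone.hull ℝ (Set.range b),
      x + y = u → ∃ c : ℝ, 0 ≤ c ∧ x = c • u) :
    ∃ (j : ι) (c : ℝ), 0 < c ∧ u = c • b j := by
  classical
  obtain ⟨c, hc, hcu⟩ := (mem_hull_range b u).1 hu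
  obtain ⟨j, hj⟩ : ∃ j, c j ≠ 0 := by
    by_contra! h
    exact hu0 (by rw [← hcu]; simp [h])
  have hgen : ∀ i, b i ∈ PointedCone.hull ℝ (Set.range b) :=
    fun i => PointedCone.subset_hull ⟨i, rfl⟩
  have hmem : ∀ i, c i • b i ∈ PointedCone.hull ℝ (Set.range b) := fun i =>
    (PointedCone.hull ℝ (Set.range b)).smul_mem (hc i) (hgen i)
  obtain ⟨a, ha, hau⟩ := hext _ (hmem j) (∑ i ∈ Finset.univ.erase j, c i • b i)
    (Submodule.sum_mem _ fun i _ => hmem i)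
    (by rw [Finset.add_sum_erase _ (fun i => c i • b i) (Finset.mem_univ j), hcu])
  have ha0 : a ≠ 0 := by
    rintro rfl
    rw [zero_smul] at hau
    exact (smul_ne_zero hj (hb.ne_zero j)) hau
  refine ⟨j, a⁻¹ * c j, mul_pos (inv_pos.2 (lt_of_le_of_ne ha ha0.symm))
    (lt_of_le_of_ne (hc j) hj.symm), ?_⟩
  rw [mul_smul, hau, smul_smul, inv_mul_cancel₀ ha0, one_smul]

/-- The generators of a simplicial cone span extremal rays. -/
theorem extremal_of_generator {E ι : Type*} [AddCommGroup E] [Module ℝ E] [Fintype ι]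
    {b : ι → E} (hb : LinearIndependent ℝ b) (j : ι) {x y : E}
    (hx : x ∈ PointedCone.hull ℝ (Set.range b)) (hy : y ∈ PointedCone.hull ℝ (Set.range b))
    (hxy : x + y = b j) : ∃ c : ℝ, 0 ≤ c ∧ x = c • b j := by
  classical
  obtain ⟨α, hα, rfl⟩ := (mem_hull_range b x).1 hx
  obtain ⟨β, hβ, rfl⟩ := (mem_hull_range b y).1 hy
  have h0 : ∀ i, i ≠ j → α i = 0 := by
    intro i hij
    have h1 : ∑ i, (α i + β i - if i = j then 1 else 0) • b i = 0 := by
      simp only [sub_smul, add_smul, Finset.sum_sub_distrib, Finset.sum_add_distrib, hxy, ite_smul,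
        one_smul, zero_smul, Finset.sum_ite_eq', Finset.mem_univ, if_true, sub_self]
    have h2 := (Fintype.linearIndependent_iff.1 hb) _ h1 i
    simp only [hij, if_false, sub_zero] at h2
    linarith [hα i, hβ i]
  refine ⟨α j, hα j, ?_⟩
  exact Finset.sum_eq_single j (fun i _ hij => by rw [h0 i hij, zero_smul]) (by simp)

/-! ### The rank one forms -/

theorem rankOne_apply {n : ℕ} (v : Fin n → ℚ) (i j : Fin n) :
    (rankOne v : Matrix (Fin n) (Fin n) ℝ) i j = (v i : ℝ) * (v j : ℝ) := rfl

theorem rankOne_neg {n : ℕ} (v : Fin n → ℚ) : rankOne (-v) = rankOne v := by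
  apply Subtype.ext
  ext i j
  simp [rankOne_apply]

theorem rankOne_ne_zero {n : ℕ} (v : Vec n) : rankOne (v : Fin n → ℚ) ≠ 0 := by
  obtain ⟨k, hk⟩ := Function.ne_iff.1 v.2
  intro h
  have := congrFun (congrFun (congrArg (fun x : SymMat n => (x : Matrix (Fin n) (Fin n) ℝ)) h) k) k
  simp only [rankOne_apply] at this
  exact hk (by simpa using this)

/-- The ray of `v'` determines the line of `v`. -/
theorem exists_eq_smul_of_rankOne_eq {n : ℕ} {v w : Vec n} {c : ℝ}
    (h : rankOne (w : Fin n → ℚ) = c • rankOne (v : Fin n → ℚ)) :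
    ∃ a : ℚ, a ≠ 0 ∧ (w : Fin n → ℚ) = a • (v : Fin n → ℚ) := by
  have h1 : ∀ i j, ((w.1 i : ℝ)) * (w.1 j : ℝ) = c * ((v.1 i : ℝ) * (v.1 j : ℝ)) := fun i j =>
    congrFun (congrFun (congrArg (fun x : SymMat n => (x : Matrix (Fin n) (Fin n) ℝ)) h) i) j
  obtain ⟨k, hk⟩ := Function.ne_iff.1 w.2
  have hk' : (w.1 k : ℝ) ≠ 0 := by exact_mod_cast hk
  have hvk : (v.1 k : ℝ) ≠ 0 := by
    intro h0
    have := h1 k k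
    rw [h0] at this
    simp at this
    exact hk (by exact_mod_cast this)
  have hvk' : v.1 k ≠ 0 := by exact_mod_cast hvk
  refine ⟨w.1 k / v.1 k, div_ne_zero hk hvk', ?_⟩
  ext j
  have h2 : (w.1 j : ℝ) * (v.1 k : ℝ) = (w.1 k : ℝ) * (v.1 j : ℝ) := by
    have e1 := h1 k k
    have e2 := h1 k j
    apply mul_left_cancel₀ hk'
    apply mul_left_cancel₀ hvk
    linear_combination (v.1 k : ℝ) ^ 2 * e2 - (v.1 k : ℝ) * (v.1 j : ℝ) * e1
  have h3 : w.1 j * v.1 k = w.1 k * v.1 j := by exact_mod_cast h2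
  simp only [Pi.smul_apply, smul_eq_mul]
  field_simp
  exact h3

/-! ### Basic sharblies attached to simplicial cones -/

theorem basic_eq_of_smul {n m : ℕ} {v w : Fin m → Vec n}
    (h : ∀ i, ∃ a : ℚ, a ≠ 0 ∧ (w i : Fin n → ℚ) = a • (v i : Fin n → ℚ)) :
    basic w = basic v := by
  classical
  have key : ∀ s : Finset (Fin m), basic (fun i => if i ∈ s then w i else v i) = basic v := by
    intro s
    induction s using Finset.induction_on with
    | empty => simp
    | insert i s hi ih =>
      rw [← ih]
      obtain ⟨a, ha, hw⟩ := h i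
      refine basic_scale _ _ i a ha (by simp [hi, hw]) fun j hj => by simp [hj]
  simpa using key Finset.univ

theorem basic_eq_sign_smul {n m : ℕ} {v w : Fin m → Vec n} (σ : Equiv.Perm (Fin m))
    (h : ∀ i, ∃ a : ℚ, a ≠ 0 ∧ (w i : Fin n → ℚ) = a • (v (σ i) : Fin n → ℚ)) :
    basic w = ((Equiv.Perm.sign σ : ℤ) : ℚ) • basic v := by
  rw [← basic_perm]
  exact basic_eq_of_smul h

/-- The simplicial cone generated by the `v_i'`. -/
noncomputable abbrev coneOf {n m : ℕ} (v : Fin m → Vec n) : Cone n :=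
  PointedCone.hull ℝ (Set.range fun i => rankOne (v i : Fin n → ℚ))

theorem isVertex_coneOf {n m : ℕ} {v : Fin m → Vec n}
    (hv : LinearIndependent ℝ fun i => rankOne (v i : Fin n → ℚ)) (i : Fin m) :
    IsVertex (coneOf v) (v i) :=
  ⟨PointedCone.subset_hull ⟨i, rfl⟩, fun _ hx _ hy hxy => extremal_of_generator hv i hx hy hxy⟩

/-- The vertices of a simplicial cone are its generators up to scaling, so independent vertices, as
many as there are generators, are a permutation of the generators up to scaling. -/
theorem exists_perm_of_isVertex {n m : ℕ} {v w : Fin m → Vec n}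
    (hv : LinearIndependent ℝ fun i => rankOne (v i : Fin n → ℚ))
    (hw : LinearIndependent ℝ fun i => rankOne (w i : Fin n → ℚ))
    (h : ∀ i, IsVertex (coneOf v) (w i)) :
    ∃ (σ : Equiv.Perm (Fin m)) (c : Fin m → ℝ), (∀ i, 0 < c i) ∧
      ∀ i, rankOne (w i : Fin n → ℚ) = c i • rankOne (v (σ i) : Fin n → ℚ) := by
  have h1 : ∀ i, ∃ (j : Fin m) (c : ℝ), 0 < c ∧
      rankOne (w i : Fin n → ℚ) = c • rankOne (v j : Fin n → ℚ) := fun i =>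
    exists_eq_smul_of_extremal hv (rankOne_ne_zero _) (h i).1 (h i).2
  choose f c hc hf using h1
  have hinj : Function.Injective f := by
    intro i j hij
    by_contra hne
    have h2 : c j • rankOne (w i : Fin n → ℚ) - c i • rankOne (w j : Fin n → ℚ) = 0 := by
      rw [hf i, hf j, hij, smul_smul, smul_smul, mul_comm, sub_self]
    have h3 := hw.comp ![i, j] (by
      intro a b hab
      fin_cases a <;> fin_cases b <;> simp_all [eq_comm])
    have h4 := Fintype.linearIndependent_iff.1 h3 ![c j, -c i]
      (by simpa [Fin.sum_univ_two, ← sub_eq_add_neg] using h2) 0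
    exact (hc j).ne' h4
  exact ⟨Equiv.ofBijective f (Finite.injective_iff_bijective.1 hinj), c, hc, hf⟩

theorem coneOf_eq_of_perm {n m : ℕ} {v w : Fin m → Vec n} (σ : Equiv.Perm (Fin m)) (c : Fin m → ℝ)
    (hc : ∀ i, 0 < c i)
    (h : ∀ i, rankOne (w i : Fin n → ℚ) = c i • rankOne (v (σ i) : Fin n → ℚ)) :
    coneOf w = coneOf v := by
  apply le_antisymm
  · refine Submodule.span_le.2 ?_
    rintro _ ⟨i, rfl⟩
    change rankOne (w i : Fin n → ℚ) ∈ coneOf v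
    rw [h i]
    exact (coneOf v).smul_mem (hc i).le (PointedCone.subset_hull ⟨σ i, rfl⟩)
  · refine Submodule.span_le.2 ?_
    rintro _ ⟨i, rfl⟩
    change rankOne (v i : Fin n → ℚ) ∈ coneOf w
    have h1 : rankOne (v i : Fin n → ℚ) =
        (c (σ.symm i))⁻¹ • rankOne (w (σ.symm i) : Fin n → ℚ) := by
      rw [h, smul_smul, inv_mul_cancel₀ (hc _).ne', one_smul, Equiv.apply_symm_apply]
    rw [h1]
    exact (coneOf w).smul_mem (inv_pos.2 (hc _)).le (PointedCone.subset_hull ⟨_, rfl⟩)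

theorem exists_perm_of_coneOf_eq {n m : ℕ} {v w : Fin m → Vec n}
    (hv : LinearIndependent ℝ fun i => rankOne (v i : Fin n → ℚ))
    (hw : LinearIndependent ℝ fun i => rankOne (w i : Fin n → ℚ))
    (h : coneOf v = coneOf w) :
    ∃ (σ : Equiv.Perm (Fin m)) (c : Fin m → ℝ), (∀ i, 0 < c i) ∧
      ∀ i, rankOne (w i : Fin n → ℚ) = c i • rankOne (v (σ i) : Fin n → ℚ) :=
  exists_perm_of_isVertex hv hw fun i => h ▸ isVertex_coneOf hw i

theorem IsOrientedList.linearIndependent {n : ℕ} {o : Orientation ℝ (SymMat n) (Fin (dimY n))}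
    {s : Cone n} {v : Fin (dimY n) → Vec n} (h : IsOrientedList o s v) :
    LinearIndependent ℝ fun i => rankOne (v i : Fin n → ℚ) := by
  obtain ⟨-, b, hb, -⟩ := h
  have := b.linearIndependent
  rwa [show (b : Fin (dimY n) → SymMat n) = fun i => rankOne (v i : Fin n → ℚ) from funext hb]
    at this

/-- The sharbly `[s]` of a simplicial cone does not depend on the oriented list of vertices. -/
theorem IsOrientedList.basic_eq {n : ℕ} {o : Orientation ℝ (SymMat n) (Fin (dimY n))}
    {s : Cone n} {v w : Fin (dimY n) → Vec n} (hv : IsOrientedList o s v)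
    (hw : IsOrientedList o s w) : basic w = basic v := by
  obtain ⟨σ, c, hc, h⟩ := exists_perm_of_coneOf_eq hv.linearIndependent hw.linearIndependent
    (hv.1.symm.trans hw.1)
  obtain ⟨-, b, hb, hbo⟩ := hv
  obtain ⟨-, b', hb', hbo'⟩ := hw
  have hdet : 0 < b.det b' := (b.orientation_eq_iff_det_pos b').1 (hbo.trans hbo'.symm)
  have h1 : b.det b' = (∏ i, c i) * ((Equiv.Perm.sign σ : ℤ) : ℝ) := by
    have e : (b' : Fin (dimY n) → SymMat n) = fun i => c i • (b ∘ σ) i := by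
      funext i
      rw [hb', h i, Function.comp, hb]
    rw [e]
    erw [MultilinearMap.map_smul_univ]
    have e2 := b.det.map_perm b σ
    rw [b.det_self] at e2
    erw [e2]
    rw [Units.smul_def, zsmul_eq_mul, mul_one, smul_eq_mul]
  have hs : Equiv.Perm.sign σ = 1 := by
    rcases Int.units_eq_one_or (Equiv.Perm.sign σ) with h2 | h2
    · exact h2
    · rw [h1, h2] at hdet
      have : 0 < ∏ i, c i := Finset.prod_pos fun i _ => hc i
      norm_num at hdet
      linarith
  rw [basic_eq_sign_smul σ fun i => exists_eq_smul_of_rankOne_eq (h i), hs]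
  simp

/-- Every basis of `Y` consisting of rank one forms can be reordered to be positively oriented. -/
theorem exists_isOrientedList {n : ℕ} (hn : 2 ≤ dimY n)
    (o : Orientation ℝ (SymMat n) (Fin (dimY n))) {v : Fin (dimY n) → Vec n}
    (b : Module.Basis (Fin (dimY n)) ℝ (SymMat n)) (hb : ∀ i, b i = rankOne (v i : Fin n → ℚ)) :
    ∃ w, IsOrientedList o (coneOf v) w := by
  rcases b.orientation_eq_or_eq_neg o with h | h
  · exact ⟨v, rfl, b, hb, h.symm⟩
  · set τ : Equiv.Perm (Fin (dimY n)) := Equiv.swap ⟨0, by omega⟩ ⟨1, by omega⟩ with hτ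
    have hsign : Equiv.Perm.sign τ = -1 := Equiv.Perm.sign_swap (by simp [Fin.ext_iff])
    refine ⟨fun i => v (τ i), ?_, b.reindex τ.symm, fun i => by simp [hb], ?_⟩
    · exact (coneOf_eq_of_perm τ (fun _ => 1) (fun _ => one_pos) fun i => by simp).symm
    · rw [h, ← Module.Basis.orientation_ne_iff_eq_neg]
      intro h2
      have := (b.orientation_eq_iff_det_pos _).1 h2.symm
      have e2 := b.det.map_perm b τ
      rw [b.det_self, hsign] at e2
      rw [show (b.reindex τ.symm : Fin (dimY n) → SymMat n) = b ∘ τ by ext i; simp, e2] at this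
      norm_num at this

/-- A simplicial tile has no triangulation but the trivial one. -/
theorem IsTriangulation.eq_singleton {n : ℕ} {v : Fin (dimY n) → Vec n}
    (hv : LinearIndependent ℝ fun i => rankOne (v i : Fin n → ℚ)) {τ : Finset (Cone n)}
    (h : IsTriangulation (coneOf v) τ) : τ = {coneOf v} := by
  obtain ⟨h1, h2, -⟩ := h
  have h3 : ∀ s ∈ τ, s = coneOf v := by
    intro s hs
    obtain ⟨w, hw, hvert, rfl⟩ := h1 s hs
    obtain ⟨σ, c, hc, h⟩ := exists_perm_of_isVertex hv hw hvert
    exact coneOf_eq_of_perm σ c hc h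
  have h4 : (0 : SymMat n) ∈ ⋃ s ∈ τ, (s : Set (SymMat n)) := by
    rw [h2]
    exact (coneOf v).zero_mem
  simp only [Set.mem_iUnion] at h4
  obtain ⟨s, hs, -⟩ := h4
  refine Finset.eq_singleton_iff_unique_mem.2 ⟨h3 s hs ▸ hs, h3⟩

theorem isRegularTriangulation_singleton {n : ℕ} {v : Fin (dimY n) → Vec n}
    (hv : LinearIndependent ℝ fun i => rankOne (v i : Fin n → ℚ)) :
    IsRegularTriangulation (coneOf v) {coneOf v} := by
  refine ⟨⟨?_, by simp, ?_⟩, fun _ => 0, ?_⟩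
  · intro s hs
    rw [Finset.mem_singleton] at hs
    exact ⟨v, hv, isVertex_coneOf hv, hs⟩
  · intro s hs s' hs' hne
    rw [Finset.mem_singleton] at hs hs'
    exact absurd (hs.trans hs'.symm) hne
  · intro s hs
    rw [Finset.mem_singleton] at hs
    subst hs
    exact ⟨0, fun _ _ => rfl, fun x hx hx' => absurd hx hx'⟩

/-! ### The action of `SL_n(ℤ)` on cones and on oriented lists -/

theorem actCone_one {n : ℕ} (T : Cone n) : actCone 1 T = T := by
  rw [actCone, actY_one, PointedCone.map_id]

theorem actCone_mul {n : ℕ} (g h : SLZ n) (T : Cone n) :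
    actCone (g * h) T = actCone g (actCone h T) := by
  rw [actCone, actCone, actCone, actY_mul, PointedCone.map_map]

theorem actCone_inv_eq {n : ℕ} {g : SLZ n} {T T' : Cone n} (h : actCone g T = T') :
    actCone g⁻¹ T' = T := by
  rw [← h, ← actCone_mul, inv_mul_cancel, actCone_one]

theorem mem_coneStabilizer {n : ℕ} {g : SLZ n} {T : Cone n} :
    g ∈ coneStabilizer T ↔ actCone g T = T := Iff.rfl

/-- The action of `SL_n(ℤ)` on nonzero column vectors. -/
noncomputable abbrev slAct {n : ℕ} (g : SLZ n) (v : Vec n) : Vec n :=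
  actVec (Matrix.SpecialLinearGroup.mapGL ℚ g) v

theorem slAct_coe {n : ℕ} (g : SLZ n) (v : Vec n) :
    (slAct g v : Fin n → ℚ) =
      (g : Matrix (Fin n) (Fin n) ℤ).map (Int.cast : ℤ → ℚ) *ᵥ (v : Fin n → ℚ) := rfl

theorem rankOne_mulVec {n : ℕ} (g : SLZ n) (v : Fin n → ℚ) :
    rankOne ((g : Matrix (Fin n) (Fin n) ℤ).map (Int.cast : ℤ → ℚ) *ᵥ v) =
      actY g (rankOne v) := by
  have h : (fun i => ((((g : Matrix (Fin n) (Fin n) ℤ).map (Int.cast : ℤ → ℚ) *ᵥ v) i : ℚ) : ℝ)) =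
      (g : Matrix (Fin n) (Fin n) ℤ).map (Int.cast : ℤ → ℝ) *ᵥ (fun i => (v i : ℝ)) := by
    ext i
    simp [Matrix.mulVec, dotProduct]
  apply Subtype.ext
  change Matrix.vecMulVec _ _ = _ * Matrix.vecMulVec _ _ * _
  rw [h, Matrix.mul_vecMulVec, Matrix.vecMulVec_mul, Matrix.vecMul_transpose]

theorem rankOne_slAct {n : ℕ} (g : SLZ n) (v : Vec n) :
    rankOne (slAct g v : Fin n → ℚ) = actY g (rankOne (v : Fin n → ℚ)) :=
  rankOne_mulVec g v

theorem actCone_coneOf {n m : ℕ} (g : SLZ n) (v : Fin m → Vec n) :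
    actCone g (coneOf v) = coneOf fun i => slAct g (v i) := by
  have h : (Set.range fun i => rankOne (slAct g (v i) : Fin n → ℚ)) =
      actY g '' Set.range fun i => rankOne (v i : Fin n → ℚ) := by
    rw [← Set.range_comp]
    exact congrArg Set.range (funext fun i => rankOne_slAct g (v i))
  change _ = PointedCone.hull ℝ (Set.range fun i => rankOne (slAct g (v i) : Fin n → ℚ))
  rw [h]
  exact Submodule.map_span _ _

/-- The action of `γ ∈ SL_n(ℤ)` on `Y` as a linear automorphism. -/
noncomputable def actYEquiv {n : ℕ} (γ : SLZ n) : SymMat n ≃ₗ[ℝ] SymMat n :=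
  LinearEquiv.ofLinearMap (actY γ) (actY γ⁻¹)
    (by rw [← actY_mul, mul_inv_cancel, actY_one]) (by rw [← actY_mul, inv_mul_cancel, actY_one])

theorem actYEquiv_apply {n : ℕ} (γ : SLZ n) (x : SymMat n) : actYEquiv γ x = actY γ x := rfl

/-! ### Elements of `SL_n(ℤ)` preserve the orientation of `Y` -/

/-- The map `x ↦ A x ᵗA` on `Y`, for a real matrix `A`. -/
def congrY {n : ℕ} (A : Matrix (Fin n) (Fin n) ℝ) : SymMat n →ₗ[ℝ] SymMat n where
  toFun x := ⟨A * (x : Matrix _ _ ℝ) * Aᵀ, by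
    have hx : (x : Matrix (Fin n) (Fin n) ℝ)ᵀ = x := x.2
    change Matrix.IsSymm _
    simp [Matrix.IsSymm, Matrix.transpose_mul, Matrix.mul_assoc, hx]⟩
  map_add' x y := by
    apply Subtype.ext
    simp [Matrix.mul_add, Matrix.add_mul]
  map_smul' c x := by
    apply Subtype.ext
    simp

theorem congrY_mul {n : ℕ} (A B : Matrix (Fin n) (Fin n) ℝ) :
    congrY (A * B) = congrY A ∘ₗ congrY B := by
  ext x : 1
  apply Subtype.ext
  simp [congrY, Matrix.transpose_mul, Matrix.mul_assoc]

/-- Coordinates on `Y`: the entries on and above the diagonal. -/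
noncomputable def upperEntries (n : ℕ) :
    SymMat n ≃ₗ[ℝ] ({p : Fin n × Fin n // p.1 ≤ p.2} → ℝ) where
  toFun x p := (x : Matrix (Fin n) (Fin n) ℝ) p.1.1 p.1.2
  map_add' _ _ := rfl
  map_smul' _ _ := rfl
  invFun f := ⟨Matrix.of fun i j => f ⟨(min i j, max i j), min_le_max⟩, by
    change Matrix.IsSymm _
    ext i j
    simp [min_comm, max_comm]⟩
  left_inv x := by
    apply Subtype.ext
    ext i j
    have hx : (x : Matrix (Fin n) (Fin n) ℝ)ᵀ = x := x.2
    rcases le_total i j with h | h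
    · simp [h]
    · simpa [h] using congrFun (congrFun hx i) j
  right_inv f := by
    ext ⟨⟨i, j⟩, h⟩
    have h' : i ≤ j := h
    simp [h']

theorem prod_upper_eq {n : ℕ} (d : Fin n → ℝ) :
    ∏ p : {p : Fin n × Fin n // p.1 ≤ p.2}, d p.1.1 * d p.1.2 = (∏ i, d i) ^ (n + 1) := by
  classical
  have h1 : ∏ p : {p : Fin n × Fin n // p.1 ≤ p.2}, d p.1.1 * d p.1.2 =
      ∏ i, ∏ j, if i ≤ j then d i * d j else 1 := by
    rw [← Fintype.prod_prod_type' (f := fun i j => if i ≤ j then d i * d j else 1),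
      ← Finset.prod_filter]
    exact (Finset.prod_subtype (Finset.univ.filter fun p : Fin n × Fin n => p.1 ≤ p.2)
      (by simp) (fun p => d p.1 * d p.2)).symm
  have h2 : ∀ i : Fin n, ∏ j, (if i ≤ j then d i else 1) = d i ^ (n - (i : ℕ)) := by
    intro i
    rw [← Finset.prod_filter, Finset.prod_const, Finset.filter_le_eq_Ici, Fin.card_Ici]
  have h3 : ∀ j : Fin n, ∏ i, (if i ≤ j then d j else 1) = d j ^ ((j : ℕ) + 1) := by
    intro j
    rw [← Finset.prod_filter, Finset.prod_const, Finset.filter_ge_eq_Iic, Fin.card_Iic]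
  rw [h1]
  have h4 : ∀ i j : Fin n, (if i ≤ j then d i * d j else 1) =
      (if i ≤ j then d i else 1) * (if i ≤ j then d j else 1) := by
    intro i j
    split_ifs <;> simp
  simp only [h4, Finset.prod_mul_distrib]
  rw [Finset.prod_comm (f := fun i j => if i ≤ j then d j else 1)]
  simp only [h2, h3]
  rw [← Finset.prod_mul_distrib, ← Finset.prod_pow]
  refine Finset.prod_congr rfl fun i _ => ?_
  rw [← pow_add]
  congr 1
  have := i.2
  omega

theorem det_congrY_diagonal {n : ℕ} (d : Fin n → ℝ) :
    LinearMap.det (congrY (Matrix.diagonal d)) = (∏ i, d i) ^ (n + 1) := by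
  classical
  rw [← prod_upper_eq, ← LinearMap.det_conj _ (upperEntries n)]
  have h : ((upperEntries n : SymMat n →ₗ[ℝ] _) ∘ₗ congrY (Matrix.diagonal d) ∘ₗ
      ((upperEntries n).symm : _ →ₗ[ℝ] SymMat n)) =
      Matrix.toLin' (Matrix.diagonal fun p : {p : Fin n × Fin n // p.1 ≤ p.2} =>
        d p.1.1 * d p.1.2) := by
    apply LinearMap.ext
    intro f
    ext p
    have hp : upperEntries n ((upperEntries n).symm f) p = f p := by simp
    simp only [LinearMap.comp_apply, Matrix.toLin'_apply, Matrix.mulVec_diagonal]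
    rw [← hp]
    change (Matrix.diagonal d * (((upperEntries n).symm f : SymMat n) : Matrix (Fin n) (Fin n) ℝ) *
      (Matrix.diagonal d)ᵀ) p.1.1 p.1.2 = _
    rw [Matrix.diagonal_transpose, Matrix.mul_diagonal, Matrix.diagonal_mul]
    change _ = d p.1.1 * d p.1.2 * ((upperEntries n).symm f).1 p.1.1 p.1.2
    ring
  rw [h, LinearMap.det_toLin', Matrix.det_diagonal]

/-- Transvections act with nonnegative determinant because they are squares, and a diagonal matrix
of determinant one acts with determinant one. -/
theorem det_congrY_nonneg {n : ℕ} {A : Matrix (Fin n) (Fin n) ℝ} (hA : A.det = 1) :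
    0 ≤ LinearMap.det (congrY A) := by
  refine Matrix.diagonal_transvection_induction (fun B => 0 ≤ LinearMap.det (congrY B)) A ?_ ?_ ?_
  · intro d hd
    rw [det_congrY_diagonal, ← Matrix.det_diagonal, hd, hA, one_pow]
    exact zero_le_one
  · rintro ⟨i, j, hij, c⟩
    have h : Matrix.transvection i j c =
        Matrix.transvection i j (c / 2) * Matrix.transvection i j (c / 2) := by
      rw [Matrix.transvection_mul_transvection_same _ _ hij, add_halves]
    change 0 ≤ LinearMap.det (congrY (Matrix.transvection i j c))
    rw [h, congrY_mul, LinearMap.det_comp]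
    exact mul_self_nonneg _
  · intro B C hB hC
    rw [congrY_mul, LinearMap.det_comp]
    exact mul_nonneg hB hC

theorem det_actY_pos {n : ℕ} (g : SLZ n) : 0 < LinearMap.det (actY g) := by
  have h1 : actY g = congrY ((g : Matrix (Fin n) (Fin n) ℤ).map (Int.cast : ℤ → ℝ)) := rfl
  have h2 : ((g : Matrix (Fin n) (Fin n) ℤ).map (Int.cast : ℤ → ℝ)).det = 1 := by
    have h := (Int.castRingHom ℝ).map_det (g : Matrix (Fin n) (Fin n) ℤ)
    rw [g.2, map_one] at h
    exact h.symm
  have h3 : LinearMap.det (actY g) ≠ 0 := by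
    have := (actYEquiv g).isUnit_det'
    exact this.ne_zero
  exact lt_of_le_of_ne (h1 ▸ det_congrY_nonneg h2) h3.symm

theorem IsOrientedList.act {n : ℕ} {o : Orientation ℝ (SymMat n) (Fin (dimY n))}
    {s : Cone n} {v : Fin (dimY n) → Vec n} (h : IsOrientedList o s v) (g : SLZ n) :
    IsOrientedList o (actCone g s) fun i => slAct g (v i) := by
  obtain ⟨rfl, b, hb, hbo⟩ := h
  refine ⟨actCone_coneOf g v, b.map (actYEquiv g), fun i => ?_, ?_⟩
  · rw [Module.Basis.map_apply, hb, actYEquiv_apply, rankOne_slAct]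
  · rw [← hbo, Module.Basis.orientation_comp_linearEquiv_eq_iff_det_pos]
    exact det_actY_pos g

/-! ### The transfer map on coinvariants -/

/-- The action of `g ∈ SL_n(ℤ)` on sharblies. -/
noncomputable abbrev slSharbly {n : ℕ} (m : ℕ) (g : SLZ n) : Sharbly n m →ₗ[ℚ] Sharbly n m :=
  actSharbly m (Matrix.SpecialLinearGroup.mapGL ℚ g)

theorem slSharbly_basic {n m : ℕ} (g : SLZ n) (v : Fin m → Vec n) :
    slSharbly m g (basic v) = basic fun i => slAct g (v i) :=
  actSharbly_basic _ _

theorem slSharbly_mul {n : ℕ} (m : ℕ) (g h : SLZ n) (x : Sharbly n m) :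
    slSharbly m (g * h) x = slSharbly m g (slSharbly m h x) := by
  have := congrArg (fun f : Sharbly n m →ₗ[ℚ] Sharbly n m => f x)
    ((sharblyRep n m).map_mul (Matrix.SpecialLinearGroup.mapGL ℚ g)
      (Matrix.SpecialLinearGroup.mapGL ℚ h))
  rw [← map_mul] at this
  exact this

/-- The projection of the sharblies onto the `G`-coinvariants. -/
noncomputable abbrev coinvMk {n : ℕ} (m : ℕ) (G : Subgroup (SLZ n)) :
    Sharbly n m →ₗ[ℚ] SharblyCoinv m G :=
  Representation.Coinvariants.mk (sharblyRes m G)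

theorem coinvMk_act {n m : ℕ} {G : Subgroup (SLZ n)} {g : SLZ n} (hg : g ∈ G)
    (x : Sharbly n m) : coinvMk m G (slSharbly m g x) = coinvMk m G x :=
  Representation.Coinvariants.mk_self_apply (sharblyRes m G) ⟨g, hg⟩ x

theorem coinvMk_act_congr {n m : ℕ} {D : Subgroup (SLZ n)} [D.Normal] {g h : SLZ n}
    (hgh : (g : SLZ n ⧸ D) = h) (x : Sharbly n m) :
    coinvMk m D (slSharbly m g x) = coinvMk m D (slSharbly m h x) := by
  have h1 : h * g⁻¹ ∈ D := by
    have := QuotientGroup.eq.1 hgh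
    exact (Subgroup.Normal.mem_comm_iff inferInstance).1 this
  rw [← coinvMk_act h1 (slSharbly m g x), ← slSharbly_mul, inv_mul_cancel_right]

/-- The transfer from the coinvariants of `SL_n(ℤ)` to those of a normal subgroup `D` of finite
index: `[x] ↦ ∑ [g x]_D`, where `g` runs over representatives of `SL_n(ℤ) ⧸ D`. -/
noncomputable def transfer {n : ℕ} (m : ℕ) (D : Subgroup (SLZ n)) [D.Normal]
    [Fintype (SLZ n ⧸ D)] : SharblyCoinv m (⊤ : Subgroup (SLZ n)) →ₗ[ℚ] SharblyCoinv m D :=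
  Representation.Coinvariants.lift _
    (∑ q : SLZ n ⧸ D, coinvMk m D ∘ₗ slSharbly m q.out) fun g => LinearMap.ext fun x => by
      simp only [LinearMap.comp_apply, LinearMap.sum_apply]
      change ∑ q : SLZ n ⧸ D, coinvMk m D (slSharbly m q.out (slSharbly m (g : SLZ n) x)) = _
      refine Fintype.sum_equiv (Equiv.mulRight ((g : SLZ n) : SLZ n ⧸ D)) _ _ fun q => ?_
      rw [← slSharbly_mul]
      refine coinvMk_act_congr ?_ x
      simp

theorem transfer_mk {n m : ℕ} (D : Subgroup (SLZ n)) [D.Normal] [Fintype (SLZ n ⧸ D)]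
    (x : Sharbly n m) : transfer m D (coinvMk m ⊤ x) =
      ∑ q : SLZ n ⧸ D, coinvMk m D (slSharbly m q.out x) := by
  rw [transfer, Representation.Coinvariants.lift_mk]
  simp

theorem boundaryCoinv_mk {n m : ℕ} (G : Subgroup (SLZ n)) (x : Sharbly n m) :
    boundaryCoinv m G (coinvMk m G x) = coinvMk (m - 1) G (boundary n m x) :=
  Representation.Coinvariants.lift_mk _ _ _ _

theorem boundaryCoinv_transfer {n m : ℕ} (D : Subgroup (SLZ n)) [D.Normal]
    [Fintype (SLZ n ⧸ D)] (x : SharblyCoinv m (⊤ : Subgroup (SLZ n))) :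
    boundaryCoinv m D (transfer m D x) = transfer (m - 1) D (boundaryCoinv m ⊤ x) := by
  obtain ⟨x, rfl⟩ := Representation.Coinvariants.mk_surjective _ x
  rw [boundaryCoinv_mk, transfer_mk, transfer_mk, map_sum]
  refine Finset.sum_congr rfl fun q _ => ?_
  rw [boundaryCoinv_mk, boundary_actSharbly]

theorem coinvMap_transfer {n m : ℕ} (D : Subgroup (SLZ n)) [D.Normal] [Fintype (SLZ n ⧸ D)]
    (x : SharblyCoinv m (⊤ : Subgroup (SLZ n))) :
    coinvMap m (le_top : D ≤ ⊤) (transfer m D x) = (D.index : ℚ) • x := by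
  obtain ⟨x, rfl⟩ := Representation.Coinvariants.mk_surjective _ x
  rw [transfer_mk, map_sum]
  have h : ∀ q : SLZ n ⧸ D, coinvMap m (le_top : D ≤ ⊤) (coinvMk m D (slSharbly m q.out x)) =
      coinvMk m ⊤ x := by
    intro q
    rw [coinvMap, Representation.Coinvariants.lift_mk]
    exact coinvMk_act (Subgroup.mem_top _) x
  rw [Finset.sum_congr rfl fun q _ => h q, Finset.sum_const, Finset.card_univ,
    Subgroup.index_eq_card, Nat.card_eq_fintype_card, Nat.cast_smul_eq_nsmul]

/-! ### Orbits of tiles under a torsion-free normal subgroup -/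

/-- A transitive action with stabilizer `H` restricted to a normal subgroup `D` which meets `H`
trivially: each `D`-orbit of tiles comes from exactly `|H|` classes modulo `D`. -/
theorem card_orbit_fiber {n : ℕ} {T₀ T : Cone n} [Finite (coneStabilizer T₀)]
    {D : Subgroup (SLZ n)} [D.Normal] [Fintype (SLZ n ⧸ D)]
    (htf : ∀ g ∈ D, IsOfFinOrder g → g = 1) {k : SLZ n} (hk : actCone k T₀ = T)
    (s : Finset (SLZ n ⧸ D))
    (hs : ∀ q, q ∈ s ↔ ∃ d ∈ D, actCone d T = actCone q.out T₀) :
    s.card = Nat.card (coneStabilizer T₀) := by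
  classical
  have := Fintype.ofFinite (coneStabilizer T₀)
  rw [Nat.card_eq_fintype_card, ← Finset.card_univ]
  symm
  refine Finset.card_bij (fun h _ => ((k * (h : SLZ n) : SLZ n) : SLZ n ⧸ D)) ?_ ?_ ?_
  · intro h _
    rw [hs]
    set g := ((k * (h : SLZ n) : SLZ n) : SLZ n ⧸ D).out with hg
    have h1 : ((k * (h : SLZ n) : SLZ n) : SLZ n ⧸ D) = g := by simp [hg]
    have h2 : g * (k * (h : SLZ n))⁻¹ ∈ D :=
      (Subgroup.Normal.mem_comm_iff inferInstance).1 (QuotientGroup.eq.1 h1)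
    refine ⟨_, h2, ?_⟩
    have h3 : actCone (k * (h : SLZ n)) T₀ = T := by
      rw [actCone_mul, mem_coneStabilizer.1 h.2, hk]
    rw [← h3, ← actCone_mul, inv_mul_cancel_right]
  · intro h _ h' _ hh
    have h1 := QuotientGroup.eq.1 hh
    have h2 : (h : SLZ n)⁻¹ * h' ∈ D := by
      have e : (k * (h : SLZ n))⁻¹ * (k * (h' : SLZ n)) = (h : SLZ n)⁻¹ * h' := by group
      rwa [e] at h1
    have h3 : IsOfFinOrder ((h : SLZ n)⁻¹ * h') := by
      have : IsOfFinOrder (h⁻¹ * h') := isOfFinOrder_of_finite _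
      simpa using (Submonoid.isOfFinOrder_coe (H := (coneStabilizer T₀).toSubmonoid)).2 this
    exact Subtype.ext (inv_mul_eq_one.1 (htf _ h2 h3))
  · intro q hq
    obtain ⟨d, hd, hdq⟩ := (hs q).1 hq
    refine ⟨⟨k⁻¹ * (d⁻¹ * q.out), ?_⟩, Finset.mem_univ _, ?_⟩
    · rw [mem_coneStabilizer, actCone_mul, actCone_mul, ← hdq]
      rw [actCone_inv_eq rfl]
      exact actCone_inv_eq hk
    · have h1 : ((d⁻¹ * q.out : SLZ n) : SLZ n ⧸ D) = q.out := by
        rw [QuotientGroup.eq]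
        have e : (d⁻¹ * q.out)⁻¹ * q.out = (q.out)⁻¹ * d * (q.out)⁻¹⁻¹ := by group
        rw [e]
        exact Subgroup.Normal.conj_mem inferInstance _ hd _
      simp only [mul_inv_cancel_left]
      rw [h1]
      simp

/-- The sum of the tiles modulo a torsion-free normal subgroup is a multiple of the transfer of a
single tile. -/
theorem sum_representatives {n : ℕ} {o : Orientation ℝ (SymMat n) (Fin (dimY n))} {T₀ : Cone n}
    [Finite (coneStabilizer T₀)] {v : Fin (dimY n) → Vec n} (hv : IsOrientedList o T₀ v)
    (horb : ∀ T, IsTile T ↔ ∃ g, actCone g T₀ = T)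
    {D : Subgroup (SLZ n)} [D.Normal] [Fintype (SLZ n ⧸ D)]
    (htf : ∀ g ∈ D, IsOfFinOrder g → g = 1) {R : Finset (Cone n)}
    (hR : IsTileRepresentatives D R) {e : Cone n → Fin (dimY n) → Vec n}
    (he : ∀ T ∈ R, IsOrientedList o T (e T)) :
    ∑ T ∈ R, basicCoinv D (e T) =
      ((Nat.card (coneStabilizer T₀) : ℚ))⁻¹ • transfer (dimY n) D (basicCoinv ⊤ v) := by
  classical
  have hex : ∀ q : SLZ n ⧸ D, ∃ T, T ∈ R ∧ ∃ d ∈ D, actCone d T = actCone q.out T₀ := fun q =>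
    (hR.2 _ ((horb _).2 ⟨q.out, rfl⟩)).exists
  choose r hrR d hd hdr using hex
  have h1 : transfer (dimY n) D (basicCoinv ⊤ v) =
      ∑ q : SLZ n ⧸ D, basicCoinv D (e (r q)) := by
    rw [basicCoinv, transfer_mk]
    refine Finset.sum_congr rfl fun q _ => ?_
    have h2 := (he _ (hrR q)).act (d q)
    rw [hdr q] at h2
    rw [slSharbly_basic, h2.basic_eq (hv.act q.out), ← slSharbly_basic, coinvMk_act (hd q)]
    rfl
  have h2 : ∀ T ∈ R, (Finset.univ.filter fun q => r q = T).card =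
      Nat.card (coneStabilizer T₀) := by
    intro T hT
    obtain ⟨k, hk⟩ := (horb T).1 (hR.1 T hT)
    refine card_orbit_fiber htf hk _ fun q => ?_
    simp only [Finset.mem_filter, Finset.mem_univ, true_and]
    constructor
    · rintro rfl
      exact ⟨d q, hd q, hdr q⟩
    · intro h
      exact (hR.2 _ ((horb _).2 ⟨q.out, rfl⟩)).unique ⟨hrR q, d q, hd q, hdr q⟩ ⟨hT, h⟩
  have hpos : (Nat.card (coneStabilizer T₀) : ℚ) ≠ 0 := by
    exact_mod_cast Nat.card_pos.ne'
  rw [h1, eq_inv_smul_iff₀ hpos, ← Finset.sum_fiberwise_of_maps_to (t := R) (fun q _ => hrR q),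
    Finset.smul_sum]
  refine Finset.sum_congr rfl fun T hT => ?_
  rw [Finset.sum_congr rfl (g := fun _ => basicCoinv D (e T)) fun q hq => by
      rw [(Finset.mem_filter.1 hq).2], Finset.sum_const, h2 T hT, Nat.cast_smul_eq_nsmul]

theorem exists_tileRepresentatives {n : ℕ} {T₀ : Cone n}
    (horb : ∀ T, IsTile T ↔ ∃ g, actCone g T₀ = T)
    (D : Subgroup (SLZ n)) [D.Normal] [Fintype (SLZ n ⧸ D)] :
    ∃ R : Finset (Cone n), IsTileRepresentatives D R := by
  classical
  let S : Setoid (Cone n) :=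
    { r := fun T T' => ∃ g ∈ D, actCone g T = T'
      iseqv :=
        { refl := fun T => ⟨1, D.one_mem, actCone_one T⟩
          symm := fun ⟨g, hg, h⟩ => ⟨g⁻¹, D.inv_mem hg, actCone_inv_eq h⟩
          trans := fun ⟨g, hg, h⟩ ⟨g', hg', h'⟩ =>
            ⟨g' * g, D.mul_mem hg' hg, by rw [actCone_mul, h, h']⟩ } }
  let rep : Cone n → Cone n := fun T => (Quotient.mk S T).out
  have hrep : ∀ T, ∃ g ∈ D, actCone g (rep T) = T := fun T => Quotient.mk_out (s := S) T
  have hrep' : ∀ T T', (∃ g ∈ D, actCone g T = T') → rep T = rep T' := fun T T' h => by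
    change (Quotient.mk S T).out = (Quotient.mk S T').out
    rw [Quotient.sound (s := S) h]
  refine ⟨Finset.univ.image fun q : SLZ n ⧸ D => rep (actCone q.out T₀), ?_, ?_⟩
  · intro T hT
    obtain ⟨q, -, rfl⟩ := Finset.mem_image.1 hT
    obtain ⟨g, -, hg⟩ := hrep (actCone q.out T₀)
    exact (horb _).2 ⟨g⁻¹ * q.out, by rw [actCone_mul, actCone_inv_eq hg]⟩
  · intro T hT
    obtain ⟨k, hk⟩ := (horb T).1 hT
    refine ⟨rep T, ⟨?_, hrep T⟩, ?_⟩
    · refine Finset.mem_image.2 ⟨(k : SLZ n ⧸ D), Finset.mem_univ _, hrep' _ _ ?_⟩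
      have h1 : k * ((k : SLZ n ⧸ D).out)⁻¹ ∈ D :=
        (Subgroup.Normal.mem_comm_iff inferInstance).1 (QuotientGroup.eq.1 (by simp))
      exact ⟨_, h1, by rw [← actCone_mul, inv_mul_cancel_right, hk]⟩
    · rintro T' ⟨hT', h⟩
      obtain ⟨q, -, rfl⟩ := Finset.mem_image.1 hT'
      rw [← hrep' _ _ h, hrep' _ _ (hrep _)]

/-- If the tiles form one orbit of simplicial cones, with finite stabilizers, and one of them
becomes a cycle in the coinvariants of `SL_n(ℤ)`, then the only sharbly cycle constructed from a
torsion-free normal subgroup of finite index is the expected multiple of that tile. -/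
theorem isSharblyCycle_iff {n : ℕ} {o : Orientation ℝ (SymMat n) (Fin (dimY n))} {T₀ : Cone n}
    (hfin : Finite (coneStabilizer T₀)) {v : Fin (dimY n) → Vec n} (hv : IsOrientedList o T₀ v)
    (horb : ∀ T, IsTile T ↔ ∃ g, actCone g T₀ = T)
    (hcyc : boundaryCoinv (dimY n) ⊤ (basicCoinv (⊤ : Subgroup (SLZ n)) v) = 0)
    {D : Subgroup (SLZ n)} (hD : D.Normal) (hDfin : D.FiniteIndex)
    (htf : ∀ g ∈ D, IsOfFinOrder g → g = 1) (z : SharblyCoinv (dimY n) (⊤ : Subgroup (SLZ n))) :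
    IsSharblyCycle o (le_top : D ≤ ⊤) z ↔
      z = ((Nat.card (coneStabilizer T₀) : ℚ))⁻¹ • basicCoinv ⊤ v := by
  classical
  have : Fintype (SLZ n ⧸ D) := Fintype.ofFinite _
  have hlist : ∀ T, IsTile T → ∃ u, IsOrientedList o T u := fun T hT => by
    obtain ⟨g, rfl⟩ := (horb T).1 hT
    exact ⟨_, hv.act g⟩
  have htri : ∀ T, IsTile T → ∀ τ, IsTriangulation T τ → τ = {T} := fun T hT τ h => by
    obtain ⟨u, hu⟩ := hlist T hT
    obtain rfl := hu.1
    exact h.eq_singleton hu.linearIndependent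
  have hbd : ∀ c : ℚ, boundaryCoinv (dimY n) D
      (c • transfer (dimY n) D (basicCoinv ⊤ v)) = 0 := fun c => by
    rw [map_smul, boundaryCoinv_transfer, hcyc, map_zero, smul_zero]
  have hval : ∀ c : ℚ, ((D.relIndex ⊤ : ℚ))⁻¹ • coinvMap (dimY n) (le_top : D ≤ ⊤)
      (c • transfer (dimY n) D (basicCoinv ⊤ v)) = c • basicCoinv ⊤ v := fun c => by
    have hne : (D.index : ℚ) ≠ 0 := by exact_mod_cast hDfin.index_ne_zero
    rw [map_smul, coinvMap_transfer, Subgroup.relIndex_top_right, smul_smul, smul_smul]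
    congr 1
    field_simp
  constructor
  · rintro ⟨zD, ⟨R, τ, e, w, hR, hτ, he, -, hw, rfl, -⟩, rfl⟩
    have hτ' : ∀ T ∈ R, τ T = {T} := fun T hT => htri T (hR.1 T hT) _ (hτ T hT).1
    have he' : ∀ T ∈ R, IsOrientedList o T (e T) := fun T hT => he T hT T (by simp [hτ' T hT])
    have hsum : ∑ T ∈ R, ∑ s ∈ τ T, basicCoinv D (e s) = ∑ T ∈ R, basicCoinv D (e T) :=
      Finset.sum_congr rfl fun T hT => by rw [hτ' T hT, Finset.sum_singleton]
    rw [hsum, sum_representatives hv horb htf hR he'] at hw ⊢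
    rw [hw (hbd _), List.map_nil, List.sum_nil, add_zero, hval]
  · rintro rfl
    obtain ⟨R, hR⟩ := exists_tileRepresentatives horb D
    have : Nonempty (Fin (dimY n) → Vec n) := ⟨v⟩
    choose! e he using hlist
    have hsum : ∑ T ∈ R, ∑ s ∈ ({T} : Finset (Cone n)), basicCoinv D (e s) =
        ((Nat.card (coneStabilizer T₀) : ℚ))⁻¹ • transfer (dimY n) D (basicCoinv ⊤ v) := by
      simp only [Finset.sum_singleton]
      exact sum_representatives hv horb htf hR fun T hT => he T (hR.1 T hT)
    refine ⟨_, ⟨R, fun T => {T}, e, [], hR, ?_, ?_, by simp, fun _ => rfl, rfl, ?_⟩, ?_⟩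
    · intro T hT
      have h := he T (hR.1 T hT)
      have := isRegularTriangulation_singleton h.linearIndependent
      rwa [coneOf, ← h.1] at this
    · intro T hT s hs
      rw [Finset.mem_singleton] at hs
      exact hs ▸ he T (hR.1 T hT)
    · rw [hsum, List.map_nil, List.sum_nil, add_zero, hbd]
    · rw [hsum, List.map_nil, List.sum_nil, add_zero, hval]

/-! ### Minimal vectors modulo two -/

/-- The bilinear form of `Q` on integral vectors. -/
def formBil {n : ℕ} (Q : Matrix (Fin n) (Fin n) ℝ) (v w : Fin n → ℤ) : ℝ :=
  (fun i => (v i : ℝ)) ⬝ᵥ (Q *ᵥ fun i => (w i : ℝ))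

theorem intCast_add_fun {n : ℕ} (v w : Fin n → ℤ) :
    (fun i => (((v + w) i : ℤ) : ℝ)) = (fun i => (v i : ℝ)) + fun i => (w i : ℝ) := by
  ext i; simp

theorem formBil_comm {n : ℕ} {Q : Matrix (Fin n) (Fin n) ℝ} (hQ : Q.PosDef) (v w : Fin n → ℤ) :
    formBil Q v w = formBil Q w v := by
  have h : Qᵀ = Q := by simpa using hQ.isHermitian.eq
  rw [formBil, formBil, Matrix.dotProduct_mulVec, ← Matrix.mulVec_transpose, h, dotProduct_comm]

theorem formBil_add_left {n : ℕ} (Q : Matrix (Fin n) (Fin n) ℝ) (u v w : Fin n → ℤ) :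
    formBil Q (u + v) w = formBil Q u w + formBil Q v w := by
  rw [formBil, intCast_add_fun, add_dotProduct, formBil, formBil]

theorem formValue_add {n : ℕ} {Q : Matrix (Fin n) (Fin n) ℝ} (hQ : Q.PosDef) (v w : Fin n → ℤ) :
    formValue Q (v + w) = formValue Q v + 2 * formBil Q v w + formValue Q w := by
  have h := formBil_comm hQ w v
  simp only [formValue, formBil] at h ⊢
  rw [intCast_add_fun, Matrix.mulVec_add, add_dotProduct, dotProduct_add, dotProduct_add, h]
  ring

theorem formValue_neg {n : ℕ} (Q : Matrix (Fin n) (Fin n) ℝ) (v : Fin n → ℤ) :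
    formValue Q (-v) = formValue Q v := by
  have h : (fun i => (((-v) i : ℤ) : ℝ)) = -fun i => (v i : ℝ) := by ext i; simp
  rw [formValue, h, Matrix.mulVec_neg, neg_dotProduct_neg, formValue]

theorem formBil_neg_right {n : ℕ} (Q : Matrix (Fin n) (Fin n) ℝ) (v w : Fin n → ℤ) :
    formBil Q v (-w) = -formBil Q v w := by
  have h : (fun i => (((-w) i : ℤ) : ℝ)) = -fun i => (w i : ℝ) := by ext i; simp
  rw [formBil, h, Matrix.mulVec_neg, dotProduct_neg, formBil]

theorem formValue_pos {n : ℕ} {Q : Matrix (Fin n) (Fin n) ℝ} (hQ : Q.PosDef) {v : Fin n → ℤ}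
    (hv : v ≠ 0) : 0 < formValue Q v := by
  have h : (fun i => (v i : ℝ)) ≠ 0 := by
    obtain ⟨k, hk⟩ := Function.ne_iff.1 hv
    exact Function.ne_iff.2 ⟨k, by simpa using hk⟩
  simpa [formValue] using hQ.dotProduct_mulVec_pos h

theorem formValue_parallelogram {n : ℕ} {Q : Matrix (Fin n) (Fin n) ℝ} (hQ : Q.PosDef)
    (v w : Fin n → ℤ) : formValue Q (v + w) + formValue Q (v - w) =
      2 * formValue Q v + 2 * formValue Q w := by
  rw [sub_eq_add_neg, formValue_add hQ, formValue_add hQ, formValue_neg, formBil_neg_right]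
  ring

/-- Reduction of an integral vector modulo two. -/
def modTwo {n : ℕ} (v : Fin n → ℤ) : Fin n → ZMod 2 := fun i => (v i : ZMod 2)

theorem modTwo_add {n : ℕ} (v w : Fin n → ℤ) : modTwo (v + w) = modTwo v + modTwo w := by
  ext i; simp [modTwo]

theorem modTwo_neg {n : ℕ} (v : Fin n → ℤ) : modTwo (-v) = modTwo v := by
  ext i; simp [modTwo, ZMod.neg_eq_self_mod_two]

theorem exists_double_of_modTwo_eq_zero {n : ℕ} {v : Fin n → ℤ} (h : modTwo v = 0) :
    ∃ u, v = u + u := by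
  have h1 : ∀ i, ∃ u : ℤ, v i = u + u := by
    intro i
    have h2 : ((v i : ℤ) : ZMod 2) = 0 := congrFun h i
    obtain ⟨u, hu⟩ := (ZMod.intCast_zmod_eq_zero_iff_dvd (v i) 2).1 h2
    exact ⟨u, by rw [hu]; push_cast; ring⟩
  choose u hu using h1
  exact ⟨u, funext hu⟩

theorem minVectors_neg {n : ℕ} {Q : Matrix (Fin n) (Fin n) ℝ} {x : Fin n → ℤ}
    (hx : x ∈ minVectors Q) : -x ∈ minVectors Q :=
  ⟨neg_ne_zero.2 hx.1, fun w hw => by rw [formValue_neg]; exact hx.2 w hw⟩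

theorem formValue_eq_of_minVectors {n : ℕ} {Q : Matrix (Fin n) (Fin n) ℝ} {x y : Fin n → ℤ}
    (hx : x ∈ minVectors Q) (hy : y ∈ minVectors Q) : formValue Q x = formValue Q y :=
  le_antisymm (hx.2 y hy.1) (hy.2 x hx.1)

theorem modTwo_ne_zero {n : ℕ} {Q : Matrix (Fin n) (Fin n) ℝ} (hQ : Q.PosDef) {x : Fin n → ℤ}
    (hx : x ∈ minVectors Q) : modTwo x ≠ 0 := by
  intro h
  obtain ⟨u, rfl⟩ := exists_double_of_modTwo_eq_zero h
  have hu : u ≠ 0 := by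
    rintro rfl
    exact hx.1 (by simp)
  have h1 := hx.2 u hu
  have h2 := formValue_parallelogram hQ u u
  have h3 : formValue Q (u - u) = 0 := by simp [formValue]
  have h4 := formValue_pos hQ hu
  linarith

theorem eq_or_eq_neg_of_modTwo_eq {n : ℕ} {Q : Matrix (Fin n) (Fin n) ℝ} (hQ : Q.PosDef)
    {x y : Fin n → ℤ} (hx : x ∈ minVectors Q) (hy : y ∈ minVectors Q)
    (h : modTwo x = modTwo y) : x = y ∨ x = -y := by
  obtain ⟨u, hu⟩ : ∃ u, x + y = u + u := exists_double_of_modTwo_eq_zero (by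
    rw [modTwo_add, h]; ext i; simp [CharTwo.add_self_eq_zero])
  have hxu : x = u + (x - u) := by abel
  have hyu : y = u - (x - u) := by
    have : y = u + u - x := by rw [← hu]; abel
    rw [this]; abel
  by_contra! hne
  have h1 : u ≠ 0 := by
    rintro rfl
    exact hne.2 (eq_neg_of_add_eq_zero_left (by simpa using hu))
  have h2 : x - u ≠ 0 := fun h0 => hne.1 (by rw [hxu, hyu, h0, add_zero, sub_zero])
  have h3 := formValue_parallelogram hQ u (x - u)
  rw [← hxu, ← hyu] at h3
  have h4 := hx.2 u h1
  have h5 := hx.2 _ h2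
  have h6 := formValue_eq_of_minVectors hx hy
  have h7 := formValue_pos hQ hx.1
  linarith

/-- If `x + y + z = 2 s` then the four vectors `s`, `s - x`, `s - y`, `s - z` have total value
`Q[x] + Q[y] + Q[z]`, so for minimal vectors `x`, `y`, `z` one of the four is zero. -/
theorem eq_of_modTwo_eq_add {n : ℕ} {Q : Matrix (Fin n) (Fin n) ℝ} (hQ : Q.PosDef)
    {x y z : Fin n → ℤ} (hx : x ∈ minVectors Q) (hy : y ∈ minVectors Q) (hz : z ∈ minVectors Q)
    (h : modTwo z = modTwo x + modTwo y) :
    (z = x + y ∨ z = -(x + y)) ∨ (z = x - y ∨ z = -(x - y)) := by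
  obtain ⟨s, hs⟩ : ∃ s, x + y + z = s + s := exists_double_of_modTwo_eq_zero (by
    rw [modTwo_add, modTwo_add, h]; ext i; simp [CharTwo.add_self_eq_zero])
  have hzs : z = s + s - x - y := by rw [← hs]; abel
  by_contra! hne
  have h0 : s ≠ 0 := by
    rintro rfl
    exact hne.1.2 (by rw [hzs]; abel)
  have h1 : s - x ≠ 0 := fun h' => hne.2.1 (by rw [hzs, sub_eq_zero.1 h']; abel)
  have h2 : s - y ≠ 0 := fun h' => hne.2.2 (by rw [hzs, sub_eq_zero.1 h']; abel)
  have h3 : s - z ≠ 0 := fun h' => hne.1.1 (by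
    have : z + z = x + y + z := by rw [hs, sub_eq_zero.1 h']
    exact add_right_cancel this)
  have p1 := formValue_parallelogram hQ s (s - x)
  have p2 := formValue_parallelogram hQ (s - y) (s - z)
  have p3 := formValue_parallelogram hQ y z
  rw [show s + (s - x) = y + z by rw [hzs]; abel, show s - (s - x) = x by abel] at p1
  rw [show s - y + (s - z) = x by rw [hzs]; abel,
    show s - y - (s - z) = -(y - z) by abel, formValue_neg] at p2
  have e1 := formValue_eq_of_minVectors hx hy
  have e2 := formValue_eq_of_minVectors hx hz
  have := hx.2 _ h0
  have := hx.2 _ h1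
  have := hx.2 _ h2
  have := hx.2 _ h3
  have := formValue_pos hQ hx.1
  linarith

theorem add_mem_or_sub_mem {n : ℕ} {Q : Matrix (Fin n) (Fin n) ℝ} (hQ : Q.PosDef)
    {x y z : Fin n → ℤ} (hx : x ∈ minVectors Q) (hy : y ∈ minVectors Q) (hz : z ∈ minVectors Q)
    (h : modTwo z = modTwo x + modTwo y) : x + y ∈ minVectors Q ∨ x - y ∈ minVectors Q := by
  rcases eq_of_modTwo_eq_add hQ hx hy hz h with (h | h) | (h | h)
  · exact Or.inl (h ▸ hz)
  · exact Or.inl (by rw [← neg_eq_iff_eq_neg.2 h]; exact minVectors_neg hz)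
  · exact Or.inr (h ▸ hz)
  · exact Or.inr (by rw [← neg_eq_iff_eq_neg.2 h]; exact minVectors_neg hz)

/-- After changing the sign of `y`, the minimal vector in the class of `x + y` is `x + y`. -/
theorem exists_sign_add_mem {n : ℕ} {Q : Matrix (Fin n) (Fin n) ℝ} (hQ : Q.PosDef)
    {x y z : Fin n → ℤ} (hx : x ∈ minVectors Q) (hy : y ∈ minVectors Q) (hz : z ∈ minVectors Q)
    (h : modTwo z = modTwo x + modTwo y) :
    ∃ y' ∈ minVectors Q, modTwo y' = modTwo y ∧ x + y' ∈ minVectors Q := by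
  rcases add_mem_or_sub_mem hQ hx hy hz h with h | h
  · exact ⟨y, hy, rfl, h⟩
  · exact ⟨-y, minVectors_neg hy, modTwo_neg y, by rwa [← sub_eq_add_neg]⟩

theorem rankOne_intCast_neg {n : ℕ} (v : Fin n → ℤ) :
    rankOne (fun i => (((-v) i : ℤ) : ℚ)) = rankOne fun i => (v i : ℚ) := by
  rw [← rankOne_neg fun i => (v i : ℚ)]
  congr 1

/-- The form `v'` of a minimal vector depends only on the class of `v` modulo two, so a perfect form
needs at least `dim Y` classes. -/
theorem finrank_le_ncard_modTwo {n : ℕ} {Q : Matrix (Fin n) (Fin n) ℝ} (hQ : IsPerfectForm Q) :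
    Module.finrank ℝ (SymMat n) ≤ (modTwo '' minVectors Q).ncard := by
  classical
  have hch : ∀ r : Fin n → ZMod 2, ∃ x : Fin n → ℤ,
      r ∈ modTwo '' minVectors Q → x ∈ minVectors Q ∧ modTwo x = r := by
    intro r
    by_cases h : r ∈ modTwo '' minVectors Q
    · obtain ⟨x, hx, hr⟩ := h
      exact ⟨x, fun _ => ⟨hx, hr⟩⟩
    · exact ⟨0, fun h' => absurd h' h⟩
  choose f hf using hch
  have h1 : minRankOne Q =
      (fun r => rankOne fun i => (f r i : ℚ)) '' (modTwo '' minVectors Q) := by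
    ext y
    constructor
    · rintro ⟨x, hx, rfl⟩
      refine ⟨modTwo x, ⟨x, hx, rfl⟩, ?_⟩
      obtain ⟨hm, hr⟩ := hf (modTwo x) ⟨x, hx, rfl⟩
      rcases eq_or_eq_neg_of_modTwo_eq hQ.1 hm hx hr with h | h
      · simp only [h]
      · simp only [h]
        exact rankOne_intCast_neg x
    · rintro ⟨r, hr, rfl⟩
      exact ⟨f r, (hf r hr).1, rfl⟩
  have hfin : (minRankOne Q).Finite := by rw [h1]; exact (Set.toFinite _).image _
  have := hfin.fintype
  calc Module.finrank ℝ (SymMat n) = Module.finrank ℝ (Submodule.span ℝ (minRankOne Q)) := by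
        rw [hQ.2, finrank_top]
    _ ≤ (minRankOne Q).toFinset.card := finrank_span_le_card _
    _ = (minRankOne Q).ncard := (Set.ncard_eq_toFinset_card' _).symm
    _ ≤ _ := by rw [h1]; exact Set.ncard_image_le (Set.toFinite _)

/-! ### Bases of the lattice from minimal vectors -/

/-- The real quadratic form `y ↦ Q[M y]`. -/
def pullForm {n : ℕ} (Q : Matrix (Fin n) (Fin n) ℝ) (M : Matrix (Fin n) (Fin n) ℤ)
    (y : Fin n → ℝ) : ℝ :=
  (M.map (Int.cast : ℤ → ℝ) *ᵥ y) ⬝ᵥ (Q *ᵥ (M.map (Int.cast : ℤ → ℝ) *ᵥ y))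

theorem pullForm_eq_sum {n : ℕ} (Q : Matrix (Fin n) (Fin n) ℝ) (M : Matrix (Fin n) (Fin n) ℤ)
    (y : Fin n → ℝ) :
    pullForm Q M y = ∑ i, ∑ j, y i * y j * formBil Q (Mᵀ i) (Mᵀ j) := by
  set A := M.map (Int.cast : ℤ → ℝ) with hA
  have h1 : pullForm Q M y = y ⬝ᵥ ((Aᵀ * Q * A) *ᵥ y) := by
    rw [pullForm, ← Matrix.mulVec_mulVec, ← Matrix.mulVec_mulVec, Matrix.dotProduct_mulVec y,
      Matrix.vecMul_transpose]
  have h2 : ∀ i j, (Aᵀ * Q * A) i j = formBil Q (Mᵀ i) (Mᵀ j) := by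
    intro i j
    rw [Matrix.mul_assoc, Matrix.mul_apply']
    rfl
  rw [h1, dotProduct]
  refine Finset.sum_congr rfl fun i _ => ?_
  rw [Matrix.mulVec, dotProduct, Finset.mul_sum]
  refine Finset.sum_congr rfl fun j _ => ?_
  rw [h2]
  ring

/-- A sublattice whose covering radius is less than the minimum of the form is the whole
lattice. -/
theorem isUnit_det_of_covering {n : ℕ} {Q : Matrix (Fin n) (Fin n) ℝ}
    {M : Matrix (Fin n) (Fin n) ℤ} {m : ℝ} (hm : ∀ w : Fin n → ℤ, w ≠ 0 → m ≤ formValue Q w)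
    (h0 : ∀ y, pullForm Q M y = 0 → y = 0)
    (hcov : ∀ y : Fin n → ℝ, ∃ z : Fin n → ℤ, pullForm Q M (y - fun i => (z i : ℝ)) < m) :
    IsUnit M.det := by
  set A := M.map (Int.cast : ℤ → ℝ) with hA
  have hdet : IsUnit A.det := by
    rw [isUnit_iff_ne_zero]
    intro hd
    obtain ⟨y, hy, hAy⟩ := Matrix.exists_mulVec_eq_zero_iff.2 hd
    exact hy (h0 y (by rw [pullForm, ← hA, hAy, zero_dotProduct]))
  rw [← Matrix.isUnit_iff_isUnit_det, ← Matrix.mulVec_surjective_iff_isUnit]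
  intro x
  obtain ⟨z, hz⟩ := hcov (A⁻¹ *ᵥ fun i => (x i : ℝ))
  refine ⟨z, ?_⟩
  by_contra hne
  have hr : x - M *ᵥ z ≠ 0 := fun h => hne (sub_eq_zero.1 h).symm
  have hc : (fun i => (((x - M *ᵥ z) i : ℤ) : ℝ)) =
      A *ᵥ (A⁻¹ *ᵥ (fun i => (x i : ℝ)) - fun i => (z i : ℝ)) := by
    rw [Matrix.mulVec_sub, Matrix.mulVec_mulVec, Matrix.mul_nonsing_inv _ hdet,
      Matrix.one_mulVec]
    ext i
    simp [Matrix.mulVec, dotProduct, hA]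
  have h2 := hm _ hr
  rw [formValue, hc] at h2
  exact absurd hz (not_lt.2 h2)

theorem sq_sub_round_le (x : ℝ) : (x - round x) ^ 2 ≤ 1 / 4 := by
  have h := abs_le.1 (abs_sub_round x)
  nlinarith [h.1, h.2]

/-! ### Perfect binary forms -/

/-- The Gram matrix is that of the hexagonal lattice, with covering radius below its minimum. -/
theorem isUnit_det_binary {Q : Matrix (Fin 2) (Fin 2) ℝ} (hQ : Q.PosDef) {a b : Fin 2 → ℤ}
    (ha : a ∈ minVectors Q) (hb : b ∈ minVectors Q) (hab : a + b ∈ minVectors Q) :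
    IsUnit (Matrix.of ![a, b])ᵀ.det := by
  set m := formValue Q a with hm
  have hmpos : 0 < m := formValue_pos hQ ha.1
  have hbm : formValue Q b = m := formValue_eq_of_minVectors hb ha
  have habm : formValue Q (a + b) = m := formValue_eq_of_minVectors hab ha
  have g1 : formBil Q a b = -m / 2 := by
    have := formValue_add hQ a b
    linarith
  have hF : ∀ y, pullForm Q (Matrix.of ![a, b])ᵀ y =
      m * ((y 0 - y 1 / 2) ^ 2 + 3 / 4 * y 1 ^ 2) := by
    intro y
    have e1 : formBil Q a a = m := rfl
    have e2 : formBil Q b b = m := hbm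
    have e3 : formBil Q b a = -m / 2 := by rw [formBil_comm hQ, g1]
    rw [pullForm_eq_sum]
    have c0 : Matrix.of ![a, b] 0 = a := rfl
    have c1 : Matrix.of ![a, b] 1 = b := rfl
    simp only [Fin.sum_univ_two, Matrix.transpose_transpose, c0, c1, e1, e2, e3, g1]
    ring
  refine isUnit_det_of_covering ha.2 ?_ ?_
  · intro y hy
    rw [hF] at hy
    have h1 := (mul_eq_zero.1 hy).resolve_left hmpos.ne'
    have h2 : y 1 = 0 := by nlinarith [sq_nonneg (y 0 - y 1 / 2), sq_nonneg (y 1)]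
    have h3 : y 0 = 0 := by
      rw [h2] at h1
      nlinarith [sq_nonneg (y 0)]
    ext i
    fin_cases i
    · exact h3
    · exact h2
  · intro y
    -- The other coordinates are rounded after completing the square with the residue `β`.
    set β := y 1 - round (y 1) with hβ
    refine ⟨![round (y 0 - β / 2), round (y 1)], ?_⟩
    rw [hF]
    have h1 := sq_sub_round_le (y 1)
    have h2 := sq_sub_round_le (y 0 - β / 2)
    rw [← hβ] at h1
    simp only [Pi.sub_apply, Matrix.cons_val_zero, Matrix.cons_val_one, ← hβ]
    have h3 : (y 0 - ((round (y 0 - β / 2) : ℤ) : ℝ) - β / 2) ^ 2 ≤ 1 / 4 := by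
      rw [sub_right_comm]
      exact h2
    rw [← hm]
    nlinarith

theorem exists_minVectors_binary {Q : Matrix (Fin 2) (Fin 2) ℝ} (hQ : IsPerfectForm Q)
    (hd : Module.finrank ℝ (SymMat 2) = 3) :
    ∃ a b : Fin 2 → ℤ, a ∈ minVectors Q ∧ b ∈ minVectors Q ∧ a + b ∈ minVectors Q ∧
      ∀ x ∈ minVectors Q, ∃ y, (y = a ∨ y = b ∨ y = a + b) ∧ (x = y ∨ x = -y) := by
  have hI : modTwo '' minVectors Q = {0}ᶜ := by
    refine Set.eq_of_subset_of_ncard_le ?_ ?_ (Set.toFinite _)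
    · rintro _ ⟨x, hx, rfl⟩
      exact modTwo_ne_zero hQ.1 hx
    · have h := finrank_le_ncard_modTwo hQ
      rw [hd] at h
      refine le_trans (le_of_eq ?_) h
      rw [Set.ncard_compl, Set.ncard_singleton]
      simp
  have hmem : ∀ r : Fin 2 → ZMod 2, r ≠ 0 → ∃ x ∈ minVectors Q, modTwo x = r := by
    intro r hr
    have : r ∈ modTwo '' minVectors Q := by rw [hI]; exact hr
    exact this
  obtain ⟨a, ha, hra⟩ := hmem ![1, 0] (by decide)
  obtain ⟨b₀, hb₀, hrb₀⟩ := hmem ![0, 1] (by decide)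
  obtain ⟨c, hc, hrc⟩ := hmem ![1, 1] (by decide)
  obtain ⟨b, hb, hrb, hab⟩ := exists_sign_add_mem hQ.1 ha hb₀ hc (by rw [hra, hrb₀, hrc]; decide)
  rw [hrb₀] at hrb
  have hrab : modTwo (a + b) = ![1, 1] := by rw [modTwo_add, hra, hrb]; decide
  refine ⟨a, b, ha, hb, hab, fun x hx => ?_⟩
  have h3 : ∀ r : Fin 2 → ZMod 2, r ≠ 0 → r = ![1, 0] ∨ r = ![0, 1] ∨ r = ![1, 1] := by decide
  rcases h3 _ (modTwo_ne_zero hQ.1 hx) with h | h | h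
  · exact ⟨a, by simp, eq_or_eq_neg_of_modTwo_eq hQ.1 hx ha (h.trans hra.symm)⟩
  · exact ⟨b, by simp, eq_or_eq_neg_of_modTwo_eq hQ.1 hx hb (h.trans hrb.symm)⟩
  · exact ⟨a + b, by simp, eq_or_eq_neg_of_modTwo_eq hQ.1 hx hab (h.trans hrab.symm)⟩

/-! ### Perfect ternary forms -/

/-- The inner products of `a`, `b`, `c` are forced by the six minimal vectors. -/
theorem formBil_ternary {Q : Matrix (Fin 3) (Fin 3) ℝ} (hQ : Q.PosDef) {a b c : Fin 3 → ℤ}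
    (ha : a ∈ minVectors Q) (hb : b ∈ minVectors Q) (hc : c ∈ minVectors Q)
    (hab : a + b ∈ minVectors Q) (hbc : b + c ∈ minVectors Q) (habc : a + b + c ∈ minVectors Q) :
    formBil Q a b = -formValue Q a / 2 ∧ formBil Q b c = -formValue Q a / 2 ∧
      formBil Q a c = 0 := by
  have h1 := formValue_add hQ a b
  have h2 := formValue_add hQ b c
  have h3 := formValue_add hQ (a + b) c
  rw [formBil_add_left] at h3
  have e1 := formValue_eq_of_minVectors hb ha
  have e2 := formValue_eq_of_minVectors hc ha
  have e3 := formValue_eq_of_minVectors hab ha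
  have e4 := formValue_eq_of_minVectors hbc ha
  have e5 := formValue_eq_of_minVectors habc ha
  refine ⟨?_, ?_, ?_⟩ <;> linarith

/-- The Gram matrix is that of `A₃`, with covering radius below its minimum. -/
theorem isUnit_det_ternary {Q : Matrix (Fin 3) (Fin 3) ℝ} (hQ : Q.PosDef) {a b c : Fin 3 → ℤ}
    (ha : a ∈ minVectors Q) (hb : b ∈ minVectors Q) (hc : c ∈ minVectors Q)
    (hab : a + b ∈ minVectors Q) (hbc : b + c ∈ minVectors Q) (habc : a + b + c ∈ minVectors Q) :
    IsUnit (Matrix.of ![a, b, c])ᵀ.det := by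
  obtain ⟨g1, g2, g3⟩ := formBil_ternary hQ ha hb hc hab hbc habc
  have hbm : formValue Q b = formValue Q a := formValue_eq_of_minVectors hb ha
  have hcm : formValue Q c = formValue Q a := formValue_eq_of_minVectors hc ha
  have hmpos : 0 < formValue Q a := formValue_pos hQ ha.1
  have e1 : formBil Q a a = formValue Q a := rfl
  have hmin := ha.2
  generalize formValue Q a = m at *
  have hF : ∀ y, pullForm Q (Matrix.of ![a, b, c])ᵀ y =
      m * ((y 0 - y 1 / 2) ^ 2 + (y 2 - y 1 / 2) ^ 2 + 1 / 2 * y 1 ^ 2) := by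
    intro y
    have e2 : formBil Q b b = m := hbm
    have e3 : formBil Q c c = m := hcm
    have e4 : formBil Q b a = -m / 2 := by rw [formBil_comm hQ, g1]
    have e5 : formBil Q c b = -m / 2 := by rw [formBil_comm hQ, g2]
    have e6 : formBil Q c a = 0 := by rw [formBil_comm hQ, g3]
    rw [pullForm_eq_sum]
    have c0 : Matrix.of ![a, b, c] 0 = a := rfl
    have c1 : Matrix.of ![a, b, c] 1 = b := rfl
    have c2 : Matrix.of ![a, b, c] 2 = c := rfl
    simp only [Fin.sum_univ_three, Matrix.transpose_transpose, c0, c1, c2, e1, e2, e3, e4, e5, e6,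
      g1, g2, g3]
    ring
  refine isUnit_det_of_covering hmin ?_ ?_
  · intro y hy
    rw [hF] at hy
    have h1 := (mul_eq_zero.1 hy).resolve_left hmpos.ne'
    have s0 := sq_nonneg (y 0 - y 1 / 2)
    have s2 := sq_nonneg (y 2 - y 1 / 2)
    have s1 := sq_nonneg (y 1)
    have h2 : y 1 = 0 := pow_eq_zero_iff two_ne_zero |>.1 (by linarith)
    have h3 : y 0 - y 1 / 2 = 0 := pow_eq_zero_iff two_ne_zero |>.1 (by linarith)
    have h4 : y 2 - y 1 / 2 = 0 := pow_eq_zero_iff two_ne_zero |>.1 (by linarith)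
    rw [h2] at h3 h4
    ext i
    fin_cases i
    · simpa using h3
    · exact h2
    · simpa using h4
  · intro y
    -- The other coordinates are rounded after completing the square with the residue `β`.
    set β := y 1 - round (y 1) with hβ
    refine ⟨![round (y 0 - β / 2), round (y 1), round (y 2 - β / 2)], ?_⟩
    rw [hF]
    have h1 := sq_sub_round_le (y 1)
    have h2 := sq_sub_round_le (y 0 - β / 2)
    have h3 := sq_sub_round_le (y 2 - β / 2)
    rw [← hβ] at h1
    rw [sub_right_comm] at h2 h3
    simp only [Pi.sub_apply, Matrix.cons_val, ← hβ]
    nlinarith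

/-- The seven nonzero classes modulo two form a Fano plane. The six other than `p` are the edges of
a complete graph on four points, and `α`, `β`, `γ` is a path in it whose end edges are opposite, with
sum `p`. -/
theorem exists_path_classes (p : Fin 3 → ZMod 2) (hp : p ≠ 0) :
    ∃ α β γ : Fin 3 → ZMod 2, ((α ≠ 0 ∧ α ≠ p) ∧ (β ≠ 0 ∧ β ≠ p) ∧ (γ ≠ 0 ∧ γ ≠ p)) ∧
      ((α + β ≠ 0 ∧ α + β ≠ p) ∧ (β + γ ≠ 0 ∧ β + γ ≠ p) ∧
        (α + β + γ ≠ 0 ∧ α + β + γ ≠ p)) ∧ p = α + γ ∧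
      ∀ r, r = 0 ∨ r = p ∨ r = α ∨ r = β ∨ r = γ ∨ r = α + β ∨ r = β + γ ∨ r = α + β + γ := by
  have h : ∀ p : Fin 3 → ZMod 2, p ≠ 0 → p = ![1, 0, 0] ∨ p = ![0, 1, 0] ∨ p = ![0, 0, 1] ∨
      p = ![1, 1, 0] ∨ p = ![1, 0, 1] ∨ p = ![0, 1, 1] ∨ p = ![1, 1, 1] := by decide
  rcases h p hp with rfl | rfl | rfl | rfl | rfl | rfl | rfl
  · exact ⟨![1, 1, 0], ![0, 0, 1], ![0, 1, 0], by decide, by decide, by decide, by decide⟩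
  · exact ⟨![1, 1, 0], ![0, 0, 1], ![1, 0, 0], by decide, by decide, by decide, by decide⟩
  · exact ⟨![1, 0, 1], ![0, 1, 0], ![1, 0, 0], by decide, by decide, by decide, by decide⟩
  · exact ⟨![0, 1, 0], ![0, 0, 1], ![1, 0, 0], by decide, by decide, by decide, by decide⟩
  · exact ⟨![0, 0, 1], ![0, 1, 0], ![1, 0, 0], by decide, by decide, by decide, by decide⟩
  · exact ⟨![0, 0, 1], ![1, 0, 0], ![0, 1, 0], by decide, by decide, by decide, by decide⟩
  · exact ⟨![0, 1, 1], ![0, 1, 0], ![1, 0, 0], by decide, by decide, by decide, by decide⟩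

/-- At most one nonzero class modulo two contains no minimal vector. -/
theorem exists_missing_class {Q : Matrix (Fin 3) (Fin 3) ℝ} (hQ : IsPerfectForm Q)
    (hd : Module.finrank ℝ (SymMat 3) = 6) :
    ∃ p : Fin 3 → ZMod 2, p ≠ 0 ∧ ∀ r, r ≠ 0 → r ≠ p → ∃ x ∈ minVectors Q, modTwo x = r := by
  by_contra! h
  obtain ⟨p, hp, -, hpI⟩ := h ![1, 0, 0] (by decide)
  obtain ⟨p', hp', hne, hpI'⟩ := h p hp
  have hsub : modTwo '' minVectors Q ⊆ ({0, p, p'} : Set (Fin 3 → ZMod 2))ᶜ := by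
    rintro _ ⟨x, hx, rfl⟩ (h | h | h)
    · exact modTwo_ne_zero hQ.1 hx h
    · exact hpI x hx h
    · exact hpI' x hx h
  have h1 := Set.ncard_le_ncard hsub (Set.toFinite _)
  have h2 := finrank_le_ncard_modTwo hQ
  have h3 : ({0, p, p'} : Set (Fin 3 → ZMod 2)).ncard = 3 := by
    rw [Set.ncard_eq_three]
    exact ⟨0, p, p', hp.symm, hp'.symm, hne.symm, rfl⟩
  rw [Set.ncard_compl, h3] at h1
  have h4 : Nat.card (Fin 3 → ZMod 2) = 8 := by simp
  omega

theorem exists_minVectors_ternary {Q : Matrix (Fin 3) (Fin 3) ℝ} (hQ : IsPerfectForm Q)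
    (hd : Module.finrank ℝ (SymMat 3) = 6) :
    ∃ a b c : Fin 3 → ℤ, (a ∈ minVectors Q ∧ b ∈ minVectors Q ∧ c ∈ minVectors Q) ∧
      (a + b ∈ minVectors Q ∧ b + c ∈ minVectors Q ∧ a + b + c ∈ minVectors Q) ∧
      ∀ x ∈ minVectors Q,
        ∃ y, (y = a ∨ y = b ∨ y = c ∨ y = a + b ∨ y = b + c ∨ y = a + b + c) ∧
          (x = y ∨ x = -y) := by
  obtain ⟨p, hp, hmem⟩ := exists_missing_class hQ hd
  obtain ⟨α, β, γ, ⟨⟨hα, hα'⟩, ⟨hβ, hβ'⟩, hγ, hγ'⟩,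
    ⟨⟨hαβ, hαβ'⟩, ⟨hβγ, hβγ'⟩, hαβγ, hαβγ'⟩, hpαγ, hall⟩ := exists_path_classes p hp
  obtain ⟨a, ha, hra⟩ := hmem α hα hα'
  obtain ⟨b₀, hb₀, hrb₀⟩ := hmem β hβ hβ'
  obtain ⟨c₀, hc₀, hrc₀⟩ := hmem γ hγ hγ'
  obtain ⟨x₁, hx₁, hr₁⟩ := hmem _ hαβ hαβ'
  obtain ⟨x₂, hx₂, hr₂⟩ := hmem _ hβγ hβγ'
  obtain ⟨x₃, hx₃, hr₃⟩ := hmem _ hαβγ hαβγ'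
  obtain ⟨b, hb, hrb, hab⟩ := exists_sign_add_mem hQ.1 ha hb₀ hx₁ (by rw [hra, hrb₀, hr₁])
  rw [hrb₀] at hrb
  obtain ⟨c, hc, hrc, hbc⟩ := exists_sign_add_mem hQ.1 hb hc₀ hx₂ (by rw [hrb, hrc₀, hr₂])
  rw [hrc₀] at hrc
  -- The class of `a + b + c` lies on two lines of the Fano plane, and this fixes the signs.
  have habc : a + b + c ∈ minVectors Q := by
    have h1 := eq_of_modTwo_eq_add hQ.1 hab hc hx₃ (by rw [modTwo_add, hra, hrb, hrc, hr₃])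
    have h2 := eq_of_modTwo_eq_add hQ.1 ha hbc hx₃
      (by rw [modTwo_add, hra, hrb, hrc, hr₃, add_assoc])
    have key : x₃ = a + b + c ∨ x₃ = -(a + b + c) := by
      rcases h1 with h1 | h1
      · exact h1
      rcases h2 with h2 | h2
      · rwa [← add_assoc] at h2
      exfalso
      have hb0 : b = 0 ∨ a = c := by
        rcases h1 with h1 | h1 <;> rcases h2 with h2 | h2 <;> rw [h1] at h2
        · left; ext i; have := congrFun h2 i; simp at this ⊢; omega
        · right; ext i; have := congrFun h2 i; simp at this; omega
        · right; ext i; have := congrFun h2 i; simp at this; omega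
        · left; ext i; have := congrFun h2 i; simp at this ⊢; omega
      rcases hb0 with h | h
      · exact hb.1 h
      · refine hp ?_
        rw [hpαγ, ← hra, ← hrc, h]
        ext i
        simp [CharTwo.add_self_eq_zero]
    rcases key with h | h
    · exact h ▸ hx₃
    · rw [← neg_eq_iff_eq_neg.2 h]
      exact minVectors_neg hx₃
  refine ⟨a, b, c, ⟨ha, hb, hc⟩, ⟨hab, hbc, habc⟩, fun x hx => ?_⟩
  have hfin : ∀ y ∈ minVectors Q, modTwo x = modTwo y → (x = y ∨ x = -y) := fun y hy h =>
    eq_or_eq_neg_of_modTwo_eq hQ.1 hx hy h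
  rcases hall (modTwo x) with h | h | h | h | h | h | h | h
  · exact absurd h (modTwo_ne_zero hQ.1 hx)
  · -- `a` and `c` are orthogonal, so that `a + c` and `a - c` are not minimal.
    exfalso
    obtain ⟨-, -, g3⟩ := formBil_ternary hQ.1 ha hb hc hab hbc habc
    have e1 := formValue_add hQ.1 a c
    have e2 := formValue_parallelogram hQ.1 a c
    have e3 := formValue_pos hQ.1 ha.1
    have e4 := formValue_pos hQ.1 hc.1
    have e5 := formValue_eq_of_minVectors ha hc
    rcases add_mem_or_sub_mem hQ.1 ha hc hx (by rw [h, hpαγ, hra, hrc]) with h' | h'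
    · have := formValue_eq_of_minVectors h' ha
      linarith
    · have := formValue_eq_of_minVectors h' ha
      linarith
  · exact ⟨a, by simp, hfin a ha (h.trans hra.symm)⟩
  · exact ⟨b, by simp, hfin b hb (h.trans hrb.symm)⟩
  · exact ⟨c, by simp, hfin c hc (h.trans hrc.symm)⟩
  · exact ⟨a + b, by simp, hfin _ hab (by rw [h, modTwo_add, hra, hrb])⟩
  · exact ⟨b + c, by simp, hfin _ hbc (by rw [h, modTwo_add, hrb, hrc])⟩
  · exact ⟨a + b + c, by simp, hfin _ habc (by rw [h, modTwo_add, modTwo_add, hra, hrb, hrc])⟩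

/-! ### The action on perfect forms and on tiles -/

theorem intCast_mulVec {n : ℕ} (M : Matrix (Fin n) (Fin n) ℤ) (v : Fin n → ℤ) :
    (fun i => (((M *ᵥ v) i : ℤ) : ℝ)) = M.map (Int.cast : ℤ → ℝ) *ᵥ fun i => (v i : ℝ) := by
  ext i
  simp [Matrix.mulVec, dotProduct]

theorem rankOne_intMulVec {n : ℕ} (g : SLZ n) (v : Fin n → ℤ) :
    rankOne (fun i => ((((g : Matrix (Fin n) (Fin n) ℤ) *ᵥ v) i : ℤ) : ℚ)) =
      actY g (rankOne fun i => (v i : ℚ)) := by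
  rw [← rankOne_mulVec]
  congr 1
  ext i
  simp [Matrix.mulVec, dotProduct]

theorem inv_mulVec_mulVec {n : ℕ} (g : SLZ n) (v : Fin n → ℤ) :
    ((g⁻¹ : SLZ n) : Matrix (Fin n) (Fin n) ℤ) *ᵥ ((g : Matrix (Fin n) (Fin n) ℤ) *ᵥ v) = v := by
  rw [Matrix.mulVec_mulVec, ← Matrix.SpecialLinearGroup.coe_mul, inv_mul_cancel,
    Matrix.SpecialLinearGroup.coe_one, Matrix.one_mulVec]

theorem mulVec_inv_mulVec {n : ℕ} (g : SLZ n) (v : Fin n → ℤ) :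
    (g : Matrix (Fin n) (Fin n) ℤ) *ᵥ (((g⁻¹ : SLZ n) : Matrix (Fin n) (Fin n) ℤ) *ᵥ v) = v := by
  rw [Matrix.mulVec_mulVec, ← Matrix.SpecialLinearGroup.coe_mul, mul_inv_cancel,
    Matrix.SpecialLinearGroup.coe_one, Matrix.one_mulVec]

theorem mulVec_ne_zero {n : ℕ} (g : SLZ n) {v : Fin n → ℤ} (hv : v ≠ 0) :
    (g : Matrix (Fin n) (Fin n) ℤ) *ᵥ v ≠ 0 := fun h => hv (by
  rw [← inv_mulVec_mulVec g v, h, Matrix.mulVec_zero])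

theorem mulVec_mem_minVectors {n : ℕ} {Q Q' : Matrix (Fin n) (Fin n) ℝ} (g : SLZ n)
    (h : ∀ v, formValue Q' ((g : Matrix (Fin n) (Fin n) ℤ) *ᵥ v) = formValue Q v)
    {v : Fin n → ℤ} :
    (g : Matrix (Fin n) (Fin n) ℤ) *ᵥ v ∈ minVectors Q' ↔ v ∈ minVectors Q := by
  constructor
  · rintro ⟨h0, h1⟩
    refine ⟨fun hv => h0 (by rw [hv, Matrix.mulVec_zero]), fun w hw => ?_⟩
    rw [← h, ← h]
    exact h1 _ (mulVec_ne_zero g hw)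
  · rintro ⟨h0, h1⟩
    refine ⟨mulVec_ne_zero g h0, fun w hw => ?_⟩
    rw [← mulVec_inv_mulVec g w, h, h]
    exact h1 _ (mulVec_ne_zero g⁻¹ hw)

/-- The cone of a perfect form `Q` is carried by `g` to the cone of `ᵗg⁻¹ Q g⁻¹`. -/
theorem IsTile.act {n : ℕ} {T : Cone n} (hT : IsTile T) (g : SLZ n) : IsTile (actCone g T) := by
  obtain ⟨Q, ⟨hpos, hspan⟩, rfl⟩ := hT
  set B := ((g⁻¹ : SLZ n) : Matrix (Fin n) (Fin n) ℤ).map (Int.cast : ℤ → ℝ) with hB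
  have hdet : IsUnit B := by
    rw [Matrix.isUnit_iff_isUnit_det]
    have h := (Int.castRingHom ℝ).map_det ((g⁻¹ : SLZ n) : Matrix (Fin n) (Fin n) ℤ)
    rw [(g⁻¹).2, map_one] at h
    rw [hB]
    exact h ▸ isUnit_one
  have hval : ∀ v, formValue (Bᴴ * Q * B) ((g : Matrix (Fin n) (Fin n) ℤ) *ᵥ v) =
      formValue Q v := by
    intro v
    have h1 : B *ᵥ (fun i => ((((g : Matrix (Fin n) (Fin n) ℤ) *ᵥ v) i : ℤ) : ℝ)) =
        fun i => (v i : ℝ) := by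
      rw [hB, ← intCast_mulVec, inv_mulVec_mulVec]
    rw [formValue, ← Matrix.mulVec_mulVec, ← Matrix.mulVec_mulVec, h1, Matrix.dotProduct_mulVec,
      Matrix.conjTranspose_eq_transpose_of_trivial, Matrix.vecMul_transpose, h1, formValue]
  have hmin : minRankOne (Bᴴ * Q * B) = actY g '' minRankOne Q := by
    ext y
    constructor
    · rintro ⟨x, hx, rfl⟩
      refine ⟨_, ⟨((g⁻¹ : SLZ n) : Matrix (Fin n) (Fin n) ℤ) *ᵥ x, ?_, rfl⟩, ?_⟩
      · rw [← mulVec_mem_minVectors g hval, mulVec_inv_mulVec]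
        exact hx
      · change actY g (rankOne fun i =>
          (((((g⁻¹ : SLZ n) : Matrix (Fin n) (Fin n) ℤ) *ᵥ x) i : ℤ) : ℚ)) = _
        rw [← rankOne_intMulVec, mulVec_inv_mulVec]
    · rintro ⟨_, ⟨x, hx, rfl⟩, rfl⟩
      exact ⟨_, (mulVec_mem_minVectors g hval).2 hx, rankOne_intMulVec g x⟩
  refine ⟨Bᴴ * Q * B, ⟨hpos.conjTranspose_mul_mul_same
    (Matrix.mulVec_injective_of_isUnit hdet), ?_⟩, ?_⟩
  · rw [hmin, Submodule.span_image, hspan, Submodule.map_top]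
    exact LinearMap.range_eq_top.2 (actYEquiv g).surjective
  · rw [hmin]
    exact Submodule.map_span _ _

theorem minRankOne_eq_range {n m : ℕ} {Q : Matrix (Fin n) (Fin n) ℝ} {V W : Fin m → Fin n → ℤ}
    (hV : ∀ i, V i ∈ minVectors Q) (hall : ∀ x ∈ minVectors Q, ∃ i, x = V i ∨ x = -V i)
    (hW : ∀ i, W i = V i ∨ W i = -V i) :
    minRankOne Q = Set.range fun i => rankOne fun k => (W i k : ℚ) := by
  have h : ∀ i, rankOne (fun k => (W i k : ℚ)) = rankOne fun k => (V i k : ℚ) := by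
    intro i
    rcases hW i with h | h
    · rw [h]
    · rw [h, rankOne_intCast_neg]
  ext y
  constructor
  · rintro ⟨x, hx, rfl⟩
    obtain ⟨i, hi⟩ := hall x hx
    refine ⟨i, (h i).trans ?_⟩
    rcases hi with rfl | rfl
    · rfl
    · exact (rankOne_intCast_neg _).symm
  · rintro ⟨i, rfl⟩
    exact ⟨V i, hV i, (h i).symm⟩

/-! ### Cones generated by lists of integral vectors -/

/-- A list of nonzero integral vectors, as a list of nonzero rational vectors. -/
def intList {n m : ℕ} (S : Fin m → Fin n → ℤ) (hS : ∀ i, S i ≠ 0) : Fin m → Vec n := fun i =>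
  ⟨fun k => (S i k : ℚ), fun h => hS i (funext fun k => Int.cast_eq_zero.1 (congrFun h k))⟩

theorem slAct_intList {n m : ℕ} {S : Fin m → Fin n → ℤ} {hS : ∀ i, S i ≠ 0} (g : SLZ n)
    (i : Fin m) : (slAct g (intList S hS i) : Fin n → ℚ) =
      fun k => ((((g : Matrix (Fin n) (Fin n) ℤ) *ᵥ S i) k : ℤ) : ℚ) := by
  rw [slAct_coe]
  ext k
  simp [Matrix.mulVec, dotProduct, intList]

/-- An element of the stabilizer permutes the primitive generators of the extremal rays up to
sign. -/
theorem mulVec_eq_or_eq_neg_of_stabilizes {n m : ℕ} {S : Fin m → Fin n → ℤ} {hS : ∀ i, S i ≠ 0}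
    (hli : LinearIndependent ℝ fun i => rankOne (intList S hS i : Fin n → ℚ))
    (hunit : ∀ i, ∃ k, S i k = 1) {g : SLZ n}
    (hg : actCone g (coneOf (intList S hS)) = coneOf (intList S hS)) (i : Fin m) :
    ∃ j, (g : Matrix (Fin n) (Fin n) ℤ) *ᵥ S i = S j ∨
      (g : Matrix (Fin n) (Fin n) ℤ) *ᵥ S i = -S j := by
  have hli' : LinearIndependent ℝ fun i => rankOne (slAct g (intList S hS i) : Fin n → ℚ) := by
    have h1 := hli.map' (actYEquiv g : SymMat n →ₗ[ℝ] SymMat n) (actYEquiv g).ker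
    rwa [show (fun i => rankOne (slAct g (intList S hS i) : Fin n → ℚ)) =
      (actYEquiv g : SymMat n →ₗ[ℝ] SymMat n) ∘ fun i => rankOne (intList S hS i : Fin n → ℚ) from
        funext fun i => rankOne_slAct g _]
  rw [actCone_coneOf] at hg
  obtain ⟨σ, c, -, h⟩ := exists_perm_of_coneOf_eq hli hli' hg.symm
  obtain ⟨a, -, ha⟩ := exists_eq_smul_of_rankOne_eq (h i)
  rw [slAct_intList] at ha
  obtain ⟨k, hk⟩ := hunit (σ i)
  obtain ⟨l, hl⟩ := hunit i
  set u := (g : Matrix (Fin n) (Fin n) ℤ) *ᵥ S i with hu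
  have hak : a = (u k : ℚ) := by
    have := congrFun ha k
    simp only [intList, Pi.smul_apply, hk, smul_eq_mul, Int.cast_one, mul_one] at this
    exact this.symm
  have h1 : u = u k • S (σ i) := by
    ext r
    have := congrFun ha r
    simp only [intList, Pi.smul_apply, smul_eq_mul, hak] at this
    simp only [Pi.smul_apply, smul_eq_mul]
    exact_mod_cast this
  have h2 : S i = u k • (((g⁻¹ : SLZ n) : Matrix (Fin n) (Fin n) ℤ) *ᵥ S (σ i)) := by
    rw [← Matrix.mulVec_smul, ← h1, hu, inv_mulVec_mulVec]
  have h3 : IsUnit (u k) := by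
    have := congrFun h2 l
    rw [hl] at this
    exact IsUnit.of_mul_eq_one _ this.symm
  refine ⟨σ i, ?_⟩
  rcases Int.isUnit_iff.1 h3 with h4 | h4
  · left
    rw [h1, h4, one_smul]
  · right
    rw [h1, h4, neg_one_smul]

theorem finite_coneStabilizer {n m : ℕ} {S : Fin m → Fin n → ℤ} {hS : ∀ i, S i ≠ 0}
    (hli : LinearIndependent ℝ fun i => rankOne (intList S hS i : Fin n → ℚ))
    (hunit : ∀ i, ∃ k, S i k = 1) (hbasis : ∀ k, ∃ i, S i = Pi.single k 1) (g : SLZ n) :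
    Finite (coneStabilizer (actCone g (coneOf (intList S hS)))) := by
  let F : Set (Fin n → ℤ) := Set.range S ∪ Set.range fun i => -S i
  have hF : F.Finite := (Set.finite_range _).union (Set.finite_range _)
  have := hF.to_subtype
  have hcol : ∀ h : coneStabilizer (actCone g (coneOf (intList S hS))), ∀ k,
      ((g⁻¹ * (h : SLZ n) * g : SLZ n) : Matrix (Fin n) (Fin n) ℤ) *ᵥ Pi.single k 1 ∈ F := by
    intro h k
    obtain ⟨i, hi⟩ := hbasis k
    have hst : actCone (g⁻¹ * (h : SLZ n) * g) (coneOf (intList S hS)) = coneOf (intList S hS) := by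
      rw [actCone_mul, actCone_mul, mem_coneStabilizer.1 h.2, actCone_inv_eq rfl]
    obtain ⟨j, hj | hj⟩ := mulVec_eq_or_eq_neg_of_stabilizes hli hunit hst i
    · exact Or.inl ⟨j, by rw [← hi, hj]⟩
    · exact Or.inr ⟨j, by rw [← hi, hj]⟩
  refine Finite.of_injective (β := Fin n → F) (fun h k => ⟨_, hcol h k⟩) fun h h' hh => ?_
  have h1 : (g⁻¹ * (h : SLZ n) * g : SLZ n) = g⁻¹ * (h' : SLZ n) * g := by
    apply Subtype.ext
    apply Matrix.ext_of_mulVec_single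
    intro k
    exact congrArg Subtype.val (congrFun hh k)
  exact Subtype.ext (mul_left_cancel (mul_right_cancel h1))

/-- If every face of a simplex has an odd symmetry in `SL_n(ℤ)`, then the simplex is a cycle in the
coinvariants: such a symmetry identifies the face with its negative. -/
theorem boundaryCoinv_eq_zero_of_symmetries {n m : ℕ} {S : Fin (m + 1) → Fin n → ℤ}
    {hS : ∀ i, S i ≠ 0}
    (hface : ∀ i : Fin (m + 1), ∃ (g : SLZ n) (p q : Fin m), p ≠ q ∧ ∀ j,
      (g : Matrix (Fin n) (Fin n) ℤ) *ᵥ S (i.succAbove j) = S (i.succAbove (Equiv.swap p q j)) ∨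
      (g : Matrix (Fin n) (Fin n) ℤ) *ᵥ S (i.succAbove j) =
        -S (i.succAbove (Equiv.swap p q j))) :
    boundaryCoinv (m + 1) ⊤ (basicCoinv (⊤ : Subgroup (SLZ n)) (intList S hS)) = 0 := by
  rw [basicCoinv]
  refine (boundaryCoinv_mk ⊤ _).trans ?_
  rw [boundary_basic]
  refine (map_sum (coinvMk m ⊤) _ _).trans (Finset.sum_eq_zero fun i _ => ?_)
  obtain ⟨g, p, q, hpq, h⟩ := hface i
  set f : Fin m → Vec n := fun j => intList S hS (i.succAbove j) with hf
  have h1 : slSharbly m g (basic f) = -basic f := by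
    rw [slSharbly_basic, basic_eq_sign_smul (v := f) (Equiv.swap p q), Equiv.Perm.sign_swap hpq]
    · simp
    · intro j
      rw [hf, slAct_intList]
      rcases h j with h | h
      · exact ⟨1, one_ne_zero, by rw [h, one_smul]; rfl⟩
      · refine ⟨-1, neg_ne_zero.2 one_ne_zero, ?_⟩
        rw [h, neg_one_smul]
        ext k
        simp [intList]
  have h2 := coinvMk_act (Subgroup.mem_top g) (basic f)
  rw [h1, map_neg] at h2
  have h3 : coinvMk m (⊤ : Subgroup (SLZ n)) (basic f) = 0 := by
    have h4 : (2 : ℚ) • coinvMk m (⊤ : Subgroup (SLZ n)) (basic f) = 0 := by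
      rw [two_smul]
      nth_rewrite 1 [← h2]
      exact neg_add_cancel _
    exact (smul_eq_zero.1 h4).resolve_left two_ne_zero
  exact (map_smul (coinvMk m ⊤) _ _).trans (by rw [h3, smul_zero])

/-- The conclusion of the theorem, for a rank in which all perfect forms are equivalent to one
whose minimal vectors are the `± S i`. -/
theorem sharblyCycle_of_roots {n : ℕ} (o : Orientation ℝ (SymMat n) (Fin (dimY n)))
    (hn : 2 ≤ dimY n) {S : Fin (dimY n) → Fin n → ℤ} {hS : ∀ i, S i ≠ 0}
    (b : Module.Basis (Fin (dimY n)) ℝ (SymMat n))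
    (hb : ∀ i, b i = rankOne (intList S hS i : Fin n → ℚ))
    (hunit : ∀ i, ∃ k, S i k = 1) (hbasis : ∀ k, ∃ i, S i = Pi.single k 1)
    (hex : ∃ Q : Matrix (Fin n) (Fin n) ℝ, IsPerfectForm Q)
    (hclass : ∀ Q : Matrix (Fin n) (Fin n) ℝ, IsPerfectForm Q → ∃ g : SLZ n,
      minRankOne Q = Set.range fun i => rankOne fun k =>
        ((((g : Matrix (Fin n) (Fin n) ℤ) *ᵥ S i) k : ℤ) : ℚ))
    (hcyc : boundaryCoinv (dimY n) ⊤
      (basicCoinv (⊤ : Subgroup (SLZ n)) (intList S hS)) = 0) :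
    (∃ T : Cone n, IsTile T) ∧
    (∀ T T' : Cone n, IsTile T → IsTile T' → ∃ g : SLZ n, actCone g T = T') ∧
    ∀ T₀ : Cone n, IsTile T₀ →
      (∃ v : Fin (dimY n) → Vec n, IsOrientedList o T₀ v) ∧
      Finite (coneStabilizer T₀) ∧
      ∀ v : Fin (dimY n) → Vec n, IsOrientedList o T₀ v →
        boundaryCoinv (dimY n) ⊤ (basicCoinv (⊤ : Subgroup (SLZ n)) v) = 0 ∧
        ∀ D : Subgroup (SLZ n), D.Normal → D.FiniteIndex →
          (∀ g ∈ D, IsOfFinOrder g → g = 1) →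
          ∀ z : SharblyCoinv (dimY n) (⊤ : Subgroup (SLZ n)),
            IsSharblyCycle o (le_top : D ≤ ⊤) z ↔
              z = ((Nat.card (coneStabilizer T₀) : ℚ))⁻¹ • basicCoinv ⊤ v := by
  have hli : LinearIndependent ℝ fun i => rankOne (intList S hS i : Fin n → ℚ) := by
    have := b.linearIndependent
    rwa [show (b : Fin (dimY n) → SymMat n) =
      fun i => rankOne (intList S hS i : Fin n → ℚ) from funext hb] at this
  have hstd : ∀ T, IsTile T → ∃ g, actCone g (coneOf (intList S hS)) = T := by
    rintro T ⟨Q, hQ, rfl⟩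
    obtain ⟨g, hg⟩ := hclass Q hQ
    refine ⟨g, ?_⟩
    rw [actCone_coneOf, hg, coneOf]
    simp only [slAct_intList]
  have htrans : ∀ T T' : Cone n, IsTile T → IsTile T' → ∃ g : SLZ n, actCone g T = T' := by
    intro T T' hT hT'
    obtain ⟨g, rfl⟩ := hstd T hT
    obtain ⟨g', rfl⟩ := hstd T' hT'
    exact ⟨g' * g⁻¹, by rw [actCone_mul, actCone_inv_eq rfl]⟩
  refine ⟨?_, htrans, fun T₀ hT₀ => ?_⟩
  · obtain ⟨Q, hQ⟩ := hex
    exact ⟨_, Q, hQ, rfl⟩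
  obtain ⟨u, hu⟩ := exists_isOrientedList hn o b hb
  obtain ⟨g, hg⟩ := hstd T₀ hT₀
  have hfin : Finite (coneStabilizer T₀) := hg ▸ finite_coneStabilizer hli hunit hbasis g
  refine ⟨⟨_, hg ▸ hu.act g⟩, hfin, fun v hv => ?_⟩
  have hcyc' : boundaryCoinv (dimY n) ⊤ (basicCoinv (⊤ : Subgroup (SLZ n)) v) = 0 := by
    have h1 : basicCoinv (⊤ : Subgroup (SLZ n)) v = basicCoinv ⊤ u := by
      have h2 : basic v = slSharbly (dimY n) g (basic u) := by
        rw [slSharbly_basic]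
        exact (hg ▸ hu.act g).basic_eq hv
      rw [basicCoinv, h2]
      exact coinvMk_act (Subgroup.mem_top g) _
    obtain ⟨σ, c, -, h⟩ := exists_perm_of_coneOf_eq hli hu.linearIndependent hu.1
    rw [h1, basicCoinv, basic_eq_sign_smul σ fun i => exists_eq_smul_of_rankOne_eq (h i),
      map_smul, map_smul]
    exact (congrArg _ hcyc).trans (smul_zero _)
  refine ⟨hcyc', fun D hD hDfin htf z => ?_⟩
  refine isSharblyCycle_iff hfin hv (fun T => ⟨htrans T₀ T hT₀, ?_⟩) hcyc' hD hDfin htf z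
  rintro ⟨g, rfl⟩
  exact hT₀.act g

/-! ### The root lattices of rank two and three -/

theorem finrank_symMat (n : ℕ) : Module.finrank ℝ (SymMat n) =
    Fintype.card {p : Fin n × Fin n // p.1 ≤ p.2} := by
  rw [(upperEntries n).finrank_eq, Module.finrank_fintype_fun_eq_card]

theorem finrank_symMat_two : Module.finrank ℝ (SymMat 2) = 3 := by
  rw [finrank_symMat]
  decide

theorem finrank_symMat_three : Module.finrank ℝ (SymMat 3) = 6 := by
  rw [finrank_symMat]
  decide

/-- Linear independence of rank one forms, in terms of matrix entries. -/
theorem linearIndependent_rankOne_of {n m : ℕ} {S : Fin m → Fin n → ℤ} {hS : ∀ i, S i ≠ 0}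
    (h : ∀ c : Fin m → ℝ, (∀ k l, ∑ i, c i * ((S i k : ℝ) * (S i l : ℝ)) = 0) → ∀ i, c i = 0) :
    LinearIndependent ℝ fun i => rankOne (intList S hS i : Fin n → ℚ) := by
  rw [Fintype.linearIndependent_iff]
  intro c hc
  refine h c fun k l => ?_
  have h1 := congrFun (congrFun (congrArg
    (fun x : SymMat n => (x : Matrix (Fin n) (Fin n) ℝ)) hc) k) l
  simp only [Submodule.coe_sum, Matrix.sum_apply, Submodule.coe_smul, Matrix.smul_apply,
    smul_eq_mul, rankOne_apply, intList, Rat.cast_intCast] at h1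
  exact h1

theorem isPerfectForm_of_minVectors {n m : ℕ} {Q : Matrix (Fin n) (Fin n) ℝ} (hQ : Q.PosDef)
    {S : Fin m → Fin n → ℤ} {hS : ∀ i, S i ≠ 0} (b : Module.Basis (Fin m) ℝ (SymMat n))
    (hb : ∀ i, b i = rankOne (intList S hS i : Fin n → ℚ)) (h : ∀ i, S i ∈ minVectors Q) :
    IsPerfectForm Q := by
  refine ⟨hQ, top_le_iff.1 ?_⟩
  rw [← b.span_eq]
  refine Submodule.span_mono ?_
  rintro _ ⟨i, rfl⟩
  rw [hb]
  exact ⟨S i, h i, rfl⟩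

/-- The positive roots of `A₂`, in a basis of simple roots. -/
def roots₂ : Fin 3 → Fin 2 → ℤ := ![![1, 0], ![0, 1], ![1, 1]]

/-- The positive roots of `A₃`, in a basis of simple roots. -/
def roots₃ : Fin 6 → Fin 3 → ℤ :=
  ![![1, 0, 0], ![0, 1, 0], ![0, 0, 1], ![1, 1, 0], ![0, 1, 1], ![1, 1, 1]]

theorem roots₂_ne_zero : ∀ i, roots₂ i ≠ 0 := by decide

theorem roots₃_ne_zero : ∀ i, roots₃ i ≠ 0 := by decide

theorem linearIndependent_roots₂ :
    LinearIndependent ℝ fun i => rankOne (intList roots₂ roots₂_ne_zero i : Fin 2 → ℚ) := by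
  refine linearIndependent_rankOne_of fun c hc => ?_
  have h00 := hc 0 0
  have h11 := hc 1 1
  have h01 := hc 0 1
  simp [Fin.sum_univ_succ, roots₂] at h00 h11 h01
  intro i
  fin_cases i <;> simp <;> linarith

theorem linearIndependent_roots₃ :
    LinearIndependent ℝ fun i => rankOne (intList roots₃ roots₃_ne_zero i : Fin 3 → ℚ) := by
  refine linearIndependent_rankOne_of fun c hc => ?_
  have h00 := hc 0 0
  have h11 := hc 1 1
  have h22 := hc 2 2
  have h01 := hc 0 1
  have h02 := hc 0 2
  have h12 := hc 1 2
  simp only [Fin.sum_univ_six, roots₃, Matrix.cons_val] at h00 h11 h22 h01 h02 h12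
  norm_num at h00 h11 h22 h01 h02 h12
  intro i
  fin_cases i <;> simp <;> linarith

theorem posDef_cartan₂ : (!![2, -1; -1, 2] : Matrix (Fin 2) (Fin 2) ℝ).PosDef := by
  refine Matrix.PosDef.of_dotProduct_mulVec_pos ?_ fun x hx => ?_
  · ext i j
    fin_cases i <;> fin_cases j <;> simp
  · have h : star x ⬝ᵥ (!![2, -1; -1, 2] : Matrix (Fin 2) (Fin 2) ℝ) *ᵥ x =
        x 0 ^ 2 + (x 0 - x 1) ^ 2 + x 1 ^ 2 := by
      simp [Matrix.mulVec, dotProduct, Fin.sum_univ_two]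
      ring
    rw [h]
    by_contra! hle
    refine hx ?_
    have h0 := sq_nonneg (x 0)
    have h1 := sq_nonneg (x 1)
    have h2 := sq_nonneg (x 0 - x 1)
    have e0 : x 0 = 0 := pow_eq_zero_iff two_ne_zero |>.1 (by linarith)
    have e1 : x 1 = 0 := pow_eq_zero_iff two_ne_zero |>.1 (by linarith)
    ext i
    fin_cases i
    · exact e0
    · exact e1

theorem posDef_cartan₃ :
    (!![2, -1, 0; -1, 2, -1; 0, -1, 2] : Matrix (Fin 3) (Fin 3) ℝ).PosDef := by
  refine Matrix.PosDef.of_dotProduct_mulVec_pos ?_ fun x hx => ?_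
  · ext i j
    fin_cases i <;> fin_cases j <;> simp
  · have h : star x ⬝ᵥ (!![2, -1, 0; -1, 2, -1; 0, -1, 2] : Matrix (Fin 3) (Fin 3) ℝ) *ᵥ x =
        x 0 ^ 2 + (x 0 - x 1) ^ 2 + (x 1 - x 2) ^ 2 + x 2 ^ 2 := by
      simp [Matrix.mulVec, dotProduct, Fin.sum_univ_three]
      ring
    rw [h]
    by_contra! hle
    refine hx ?_
    have h0 := sq_nonneg (x 0)
    have h1 := sq_nonneg (x 0 - x 1)
    have h2 := sq_nonneg (x 1 - x 2)
    have h3 := sq_nonneg (x 2)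
    have e0 : x 0 = 0 := pow_eq_zero_iff two_ne_zero |>.1 (by linarith)
    have e1 : x 0 - x 1 = 0 := pow_eq_zero_iff two_ne_zero |>.1 (by linarith)
    have e2 : x 2 = 0 := pow_eq_zero_iff two_ne_zero |>.1 (by linarith)
    ext i
    fin_cases i
    · exact e0
    · change x 1 = 0
      linarith
    · exact e2

/-- A positive definite form with even integral values has minimum at least two. -/
theorem mem_minVectors_of_even {n : ℕ} {Q : Matrix (Fin n) (Fin n) ℝ} (hQ : Q.PosDef)
    (heven : ∀ w : Fin n → ℤ, ∃ t : ℤ, formValue Q w = 2 * t) {v : Fin n → ℤ} (hv : v ≠ 0)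
    (h2 : formValue Q v = 2) : v ∈ minVectors Q := by
  refine ⟨hv, fun w hw => ?_⟩
  obtain ⟨t, ht⟩ := heven w
  have hpos := formValue_pos hQ hw
  rw [ht] at hpos
  have h1 : (0 : ℤ) < t := by
    have : (0 : ℝ) < t := by linarith
    exact_mod_cast this
  have h3 : (1 : ℝ) ≤ t := by exact_mod_cast h1
  rw [h2, ht]
  linarith

theorem formValue_cartan₂ (w : Fin 2 → ℤ) : formValue !![2, -1; -1, 2] w =
    2 * ((w 0 ^ 2 - w 0 * w 1 + w 1 ^ 2 : ℤ) : ℝ) := by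
  simp [formValue, Matrix.mulVec, dotProduct, Fin.sum_univ_two]
  ring

theorem formValue_cartan₃ (w : Fin 3 → ℤ) :
    formValue !![2, -1, 0; -1, 2, -1; 0, -1, 2] w =
      2 * ((w 0 ^ 2 + w 1 ^ 2 + w 2 ^ 2 - w 0 * w 1 - w 1 * w 2 : ℤ) : ℝ) := by
  simp [formValue, Matrix.mulVec, dotProduct, Fin.sum_univ_three]
  ring

theorem roots₂_mem_minVectors (i : Fin 3) :
    roots₂ i ∈ minVectors (!![2, -1; -1, 2] : Matrix (Fin 2) (Fin 2) ℝ) := by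
  refine mem_minVectors_of_even posDef_cartan₂ (fun w => ⟨_, formValue_cartan₂ w⟩)
    (roots₂_ne_zero i) ?_
  rw [formValue_cartan₂]
  fin_cases i <;> simp [roots₂]

theorem roots₃_mem_minVectors (i : Fin 6) :
    roots₃ i ∈ minVectors (!![2, -1, 0; -1, 2, -1; 0, -1, 2] : Matrix (Fin 3) (Fin 3) ℝ) := by
  refine mem_minVectors_of_even posDef_cartan₃ (fun w => ⟨_, formValue_cartan₃ w⟩)
    (roots₃_ne_zero i) ?_
  rw [formValue_cartan₃]
  fin_cases i <;> simp [roots₃]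

/-- The minimal vectors of a perfect binary form are those of `A₂`, in a suitable basis. -/
theorem exists_minRankOne_eq_roots₂ {Q : Matrix (Fin 2) (Fin 2) ℝ} (hQ : IsPerfectForm Q) :
    ∃ g : SLZ 2, minRankOne Q = Set.range fun i => rankOne fun k =>
      ((((g : Matrix (Fin 2) (Fin 2) ℤ) *ᵥ roots₂ i) k : ℤ) : ℚ) := by
  have key : ∀ a b : Fin 2 → ℤ, a ∈ minVectors Q → b ∈ minVectors Q → a + b ∈ minVectors Q →
      (∀ x ∈ minVectors Q, ∃ y, (y = a ∨ y = b ∨ y = a + b) ∧ (x = y ∨ x = -y)) →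
      (Matrix.of ![a, b])ᵀ.det = 1 → ∃ g : SLZ 2, minRankOne Q = Set.range fun i =>
        rankOne fun k => ((((g : Matrix (Fin 2) (Fin 2) ℤ) *ᵥ roots₂ i) k : ℤ) : ℚ) := by
    intro a b ha hb hab hall hdet
    refine ⟨⟨_, hdet⟩, minRankOne_eq_range (V := ![a, b, a + b]) ?_ ?_ ?_⟩
    · intro i
      fin_cases i
      exacts [ha, hb, hab]
    · intro x hx
      obtain ⟨y, rfl | rfl | rfl, h⟩ := hall x hx
      exacts [⟨0, h⟩, ⟨1, h⟩, ⟨2, h⟩]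
    · intro i
      left
      ext k
      fin_cases i <;> simp [roots₂, Matrix.mulVec, dotProduct, Fin.sum_univ_two]
  obtain ⟨a, b, ha, hb, hab, hall⟩ := exists_minVectors_binary hQ finrank_symMat_two
  rcases Int.isUnit_iff.1 (isUnit_det_binary hQ.1 ha hb hab) with hdet | hdet
  · exact key a b ha hb hab hall hdet
  · refine key b a hb ha (add_comm a b ▸ hab) (fun x hx => ?_) ?_
    · obtain ⟨y, h1, h2⟩ := hall x hx
      rw [add_comm a b] at h1
      exact ⟨y, by tauto, h2⟩
    · simp only [Matrix.det_fin_two, Matrix.transpose_apply, Matrix.of_apply, Matrix.cons_val]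
        at hdet ⊢
      linarith

/-- The minimal vectors of a perfect ternary form are those of `A₃`, in a suitable basis. -/
theorem exists_minRankOne_eq_roots₃ {Q : Matrix (Fin 3) (Fin 3) ℝ} (hQ : IsPerfectForm Q) :
    ∃ g : SLZ 3, minRankOne Q = Set.range fun i => rankOne fun k =>
      ((((g : Matrix (Fin 3) (Fin 3) ℤ) *ᵥ roots₃ i) k : ℤ) : ℚ) := by
  obtain ⟨a, b, c, ⟨ha, hb, hc⟩, ⟨hab, hbc, habc⟩, hall⟩ :=
    exists_minVectors_ternary hQ finrank_symMat_three
  have hV : ∀ i, (![a, b, c, a + b, b + c, a + b + c] : Fin 6 → Fin 3 → ℤ) i ∈ minVectors Q := by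
    intro i
    fin_cases i
    exacts [ha, hb, hc, hab, hbc, habc]
  have hall' : ∀ x ∈ minVectors Q, ∃ i,
      x = (![a, b, c, a + b, b + c, a + b + c] : Fin 6 → Fin 3 → ℤ) i ∨
      x = -(![a, b, c, a + b, b + c, a + b + c] : Fin 6 → Fin 3 → ℤ) i := by
    intro x hx
    obtain ⟨y, rfl | rfl | rfl | rfl | rfl | rfl, h⟩ := hall x hx
    exacts [⟨0, h⟩, ⟨1, h⟩, ⟨2, h⟩, ⟨3, h⟩, ⟨4, h⟩, ⟨5, h⟩]
  have hM : ∀ i, (Matrix.of ![a, b, c])ᵀ *ᵥ roots₃ i =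
      (![a, b, c, a + b, b + c, a + b + c] : Fin 6 → Fin 3 → ℤ) i := by
    intro i
    ext k
    fin_cases i <;> simp [roots₃, Matrix.mulVec, dotProduct, Fin.sum_univ_three]
  -- In odd rank the sign of the determinant can be corrected by `-1`.
  rcases Int.isUnit_iff.1 (isUnit_det_ternary hQ.1 ha hb hc hab hbc habc) with hdet | hdet
  · exact ⟨⟨_, hdet⟩, minRankOne_eq_range hV hall' fun i => Or.inl (hM i)⟩
  · refine ⟨⟨-(Matrix.of ![a, b, c])ᵀ, ?_⟩, minRankOne_eq_range hV hall' fun i => Or.inr ?_⟩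
    · rw [Matrix.det_neg, hdet]
      simp
    · change (-(Matrix.of ![a, b, c])ᵀ) *ᵥ roots₃ i = _
      rw [Matrix.neg_mulVec, hM]

/-- Symmetries of the three faces of the simplex on the roots of `A₂`. -/
def faceSymmetry₂ : Fin 3 → SLZ 2 :=
  ![⟨!![1, -1; 2, -1], by decide⟩, ⟨!![1, -2; 1, -1], by decide⟩, ⟨!![0, 1; -1, 0], by decide⟩]

/-- Symmetries of the six faces of the simplex on the roots of `A₃`. The five roots of a face are
the edges of two triangles with a common edge; the symmetry exchanges the two other edges of one
triangle and, up to sign, fixes the remaining roots. -/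
def faceSymmetry₃ : Fin 6 → SLZ 3 :=
  ![⟨!![-1, 0, 0; -2, 1, 0; -1, 1, -1], by decide⟩,
    ⟨!![0, -1, 0; -1, 0, 0; -1, 1, -1], by decide⟩,
    ⟨!![-1, 1, -1; 0, 1, -2; 0, 0, -1], by decide⟩,
    ⟨!![1, 0, 0; 1, -1, 0; 1, 0, -1], by decide⟩,
    ⟨!![0, -1, 0; -1, 0, 0; 0, 0, -1], by decide⟩,
    ⟨!![1, 0, 0; 1, -1, 0; 0, 0, -1], by decide⟩]

theorem boundaryCoinv_roots₂ : boundaryCoinv 3 ⊤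
    (basicCoinv (⊤ : Subgroup (SLZ 2)) (intList roots₂ roots₂_ne_zero)) = 0 := by
  refine boundaryCoinv_eq_zero_of_symmetries fun i => ⟨faceSymmetry₂ i, 0, 1, by decide, ?_⟩
  revert i
  decide

theorem boundaryCoinv_roots₃ : boundaryCoinv 6 ⊤
    (basicCoinv (⊤ : Subgroup (SLZ 3)) (intList roots₃ roots₃_ne_zero)) = 0 := by
  refine boundaryCoinv_eq_zero_of_symmetries fun i =>
    ⟨faceSymmetry₃ i, (![0, 0, 1, 0, 0, 0] : Fin 6 → Fin 5) i,
      (![3, 3, 2, 4, 1, 3] : Fin 6 → Fin 5) i, ?_, ?_⟩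
  · revert i
    decide
  · revert i
    decide

end VoronoiSharbly

open VoronoiSharbly in
theorem mainTheorem5 (n : ℕ) (hn : n = 2 ∨ n = 3)
    (o : Orientation ℝ (SymMat n) (Fin (dimY n))) :
    (∃ T : Cone n, IsTile T) ∧
    (∀ T T' : Cone n, IsTile T → IsTile T' → ∃ g : SLZ n, actCone g T = T') ∧
    ∀ T₀ : Cone n, IsTile T₀ →
      (∃ v : Fin (dimY n) → Vec n, IsOrientedList o T₀ v) ∧
      Finite (coneStabilizer T₀) ∧
      ∀ v : Fin (dimY n) → Vec n, IsOrientedList o T₀ v →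
        boundaryCoinv (dimY n) ⊤ (basicCoinv (⊤ : Subgroup (SLZ n)) v) = 0 ∧
        ∀ D : Subgroup (SLZ n), D.Normal → D.FiniteIndex →
          (∀ g ∈ D, IsOfFinOrder g → g = 1) →
          ∀ z : SharblyCoinv (dimY n) (⊤ : Subgroup (SLZ n)),
            IsSharblyCycle o (le_top : D ≤ ⊤) z ↔
              z = ((Nat.card (coneStabilizer T₀) : ℚ))⁻¹ • basicCoinv ⊤ v := by
  rcases hn with rfl | rfl
  · let b : Module.Basis (Fin 3) ℝ (SymMat 2) :=
      basisOfLinearIndependentOfCardEqFinrank linearIndependent_roots₂ (by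
        rw [finrank_symMat_two, Fintype.card_fin])
    have hb : ∀ i, b i = rankOne (intList roots₂ roots₂_ne_zero i : Fin 2 → ℚ) := fun i => by
      simp [b]
    exact sharblyCycle_of_roots (n := 2) (S := roots₂) (hS := roots₂_ne_zero) o (by decide) b hb
      (by decide) (by decide)
      ⟨_, isPerfectForm_of_minVectors posDef_cartan₂ b hb roots₂_mem_minVectors⟩
      (fun Q hQ => exists_minRankOne_eq_roots₂ hQ) boundaryCoinv_roots₂
  · let b : Module.Basis (Fin 6) ℝ (SymMat 3) :=
      basisOfLinearIndependentOfCardEqFinrank linearIndependent_roots₃ (by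
        rw [finrank_symMat_three, Fintype.card_fin])
    have hb : ∀ i, b i = rankOne (intList roots₃ roots₃_ne_zero i : Fin 3 → ℚ) := fun i => by
      simp [b]
    exact sharblyCycle_of_roots (n := 3) (S := roots₃) (hS := roots₃_ne_zero) o (by decide) b hb
      (by decide) (by decide)
      ⟨_, isPerfectForm_of_minVectors posDef_cartan₃ b hb roots₃_mem_minVectors⟩
      (fun Q hQ => exists_minRankOne_eq_roots₃ hQ) boundaryCoinv_roots₃
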